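/- **Setting.** An isometry of $\mathbb{R}^n$ is written $[x,L]$ with $L\in\mathrm{O}(n)$, $x\in\mathbb{R}^n$, where $[x,L]z=L(z+x)$; the isometry group $\mathrm{I}(\mathbb{R}^n)$ carries the compact-open topology. Let $\Gamma\subset \mathrm{I}(\mathbb{R}^n)$ be a crystal group, i.e. a discrete subgroup with compact orbit space $\mathbb{R}^n/\Gamma$. Put $\Pi=\{L:[x,L]\in\Gamma \text{ for some } x\}$, $\mathcal{L}=\{x:[x,\mathrm{id}]\in\Gamma\}$, $\mathcal{L}^*=\{z\in\mathbb{R}^n: z\cdot x\in\mathbb{Z}\ \text{for all } x\in\mathcal{L}\}$ and $\Gamma^*=\{[z,M]:z\in\mathcal{L}^*,\,M\in\Pi\}$. Fix a cross-section $\gamma:\Pi\to\Gamma$, $\gamma(M)=[x_M,M]$, with $\gamma(\mathrm{id})=[0,\mathrm{id}]$. Let $R$ be a convex fundamental domain of $\Gamma^*$: a connected open set such that the sets $gR$, $g\in\Gamma^*$, are pairwise disjoint and $\bigcup_{g\in\Gamma^*} g\overline{R}=\mathbb{R}^n$. Let $\Omega$ be a set with $R\subset\Omega\subset\overline{R}$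 that contains exactly one point of each $\Gamma^*$-orbit, and equip it with Lebesgue measure $m$. Let $\pi$ be the representation of $\Gamma$ on $L^2(\mathbb{R}^n)$ given by $(\pi(g)f)(y)=f(g^{-1}y)$. Let $\chi_\omega(x)=e^{2\pi i\,\omega\cdot x}$ and let $\mathscr{F}:L^2(\mathbb{R}^n)\to L^2(\widehat{\mathbb{R}^n})$ be the Plancherel transform extending $\mathscr{F}f(\chi_\omega)=\int f(x)\,e^{2\pi i\,\omega\cdot x}\,dx$, where $\widehat{\mathbb{R}^n}$ is identified with $\mathbb{R}^n$ through $\omega\mapsto\chi_\omega$. Let $\mathscr{H}=l^2(\Pi)\otimes l^2(\mathcal{L}^*)$ (Hilbert space tensor product). For $f\in L^2(\Omega;\mathscr{H})$ and $[w,N]\in\Gamma^*$ let $I_{[w,N]}(f)(\omega)=\langle f(\omega),\delta_N\otimes\delta_w\rangle$. For $a\in L^2(\Omega)$ and $[z,M]\in\Gamma^*$ let $p'_{a,[z,M]}(y)=a(M^{-1}(y-z))$ if $M^{-1}(y-z)\in\Omega$, and $p'_{a,[z,M]}(y)=0$ otherwise. For $g\in L^2(\widehat{\mathbb{R}^n})$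 let $(X(M)g)(y)=\chi_{M^{-1}y}(x_M)\,g(y)$. A measurable range function is a family $(W_\omega)_{\omega\in\Omega}$ of closed subspaces of $\mathscr{H}$ such that $\omega\mapsto\langle P_{W_\omega}a,b\rangle$ is Lebesgue measurable for all $a,b\in\mathscr{H}$, where $P_{W_\omega}$ is the orthogonal projection onto $W_\omega$; its direct integral is regarded as the subspace $$\int_\Omega^\oplus W_\omega\,dm(\omega)=\{f\in L^2(\Omega;\mathscr{H}): f(\omega)\in W_\omega\ \text{for a.e. } \omega\in\Omega\}.$$ **Theorem.** (a) There is a unitary map $U:L^2(\widehat{\mathbb{R}^n})\to L^2(\Omega;\mathscr{H})$ such that for every $f\in L^2(\Omega;\mathscr{H})$ $$U^{-1}f=\sideset{}{\oplus}\sum_{[z,M]\in\Gamma^*}X(M)\,p'_{I_{[M^{-1}z,M]}(f),[z,M]},$$ where the summands lie in $L^2(\widehat{\mathbb{R}^n})$ and are pairwise orthogonal, and the unordered sum converges in $L^2(\widehat{\mathbb{R}^n})$. (b) A closed subspace $V\subset L^2(\mathbb{R}^n)$ is $\pi$-invariant (that is, $\pi(g)V\subset V$ for all $g\in\Gamma$)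 if and only if there is a measurable range function $(W_\omega)_{\omega\in\Omega}$ such that for almost every $\omega\in\Omega$ one has $W_\omega=l^2(\Pi)\otimes F_\omega$ for some closed subspace $F_\omega\subset l^2(\mathcal{L}^*)$, and $$\mathscr{F}(V)=\Big\{\sideset{}{\oplus}\sum_{[z,M]\in\Gamma^*}X(M)\,p'_{I_{[M^{-1}z,M]}(f),[z,M]}\;:\; f\in\int_\Omega^\oplus W_\omega\,dm(\omega)\Big\}.$$ -/

import Mathlib

open MeasureTheory
open scoped ENNReal InnerProductSpace

noncomputable section

namespace Crystal

/-- Euclidean space `ℝⁿ`.  The dual group of `ℝⁿ` is identified with `ℝⁿ` through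
`ω ↦ χ_ω`, `χ_ω(x) = exp (2πi ω·x)`; its Haar measure is then Lebesgue measure. -/
abbrev Eucl (n : ℕ) : Type := EuclideanSpace ℝ (Fin n)

/-- The group `I(ℝⁿ)` of isometries of `ℝⁿ`.  Such an isometry `g` is written `[x, L]`, with
`L` orthogonal and `x ∈ ℝⁿ`, when `g z = L (z + x)`. -/
abbrev Isom (n : ℕ) : Type := Eucl n ≃ᵃⁱ[ℝ] Eucl n

variable {n : ℕ}

theorem isom_apply (g : Isom n) (x : Eucl n) : g x = g.linearIsometryEquiv x + g 0 := by
  have h := g.map_vadd (0 : Eucl n) x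
  simpa using h

/-- The linear part `L` of `g = [x, L]`, as a group homomorphism. -/
def linPart (n : ℕ) : Isom n →* (Eucl n ≃ₗᵢ[ℝ] Eucl n) where
  toFun g := g.linearIsometryEquiv
  map_one' := by ext x; rfl
  map_mul' g h := by ext x; rfl

/-- The vector `x` of `g = [x, L]`, that is, `g z = L (z + x)`. -/
def transPart (g : Isom n) : Eucl n := (linPart n g).symm (g 0)

theorem isom_apply' (g : Isom n) (z : Eucl n) : g z = linPart n g (z + transPart g) := by
  rw [isom_apply]
  simp [transPart, linPart]

/-- The orbit equivalence relation of a group of isometries acting on `ℝⁿ`. -/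
def orbitSetoid (G : Subgroup (Isom n)) : Setoid (Eucl n) where
  r x y := ∃ g ∈ G, g x = y
  iseqv :=
    { refl := fun x => ⟨1, G.one_mem, by simp⟩
      symm := by
        rintro x y ⟨g, hg, rfl⟩
        exact ⟨g⁻¹, G.inv_mem hg, by simp⟩
      trans := by
        rintro x y z ⟨g, hg, rfl⟩ ⟨h, hh, rfl⟩
        exact ⟨h * g, G.mul_mem hh hg, by simp⟩ }

/-- A crystal group: a subgroup of `I(ℝⁿ)` that is discrete in the compact-open topology
(induced from `C(ℝⁿ, ℝⁿ)`) and has compact orbit space (quotient topology). -/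
structure IsCrystalGroup (Γ : Subgroup (Isom n)) : Prop where
  discrete : TopologicalSpace.induced
      (fun g : Γ => (⟨fun x => g.1 x, g.1.continuous⟩ : C(Eucl n, Eucl n))) inferInstance = ⊥
  cocompact : CompactSpace (Quotient (orbitSetoid Γ))

/-- The point group `Π` of `Γ`: the group of linear parts of the elements of `Γ`. -/
def pointGroup (Γ : Subgroup (Isom n)) : Subgroup (Eucl n ≃ₗᵢ[ℝ] Eucl n) :=
  Γ.map (linPart n)

/-- The translation lattice `𝓛 = {x : [x, id] ∈ Γ}`. -/
def lattice (Γ : Subgroup (Isom n)) : Set (Eucl n) :=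
  {x | ∃ g ∈ Γ, ∀ z, g z = z + x}

/-- The dual lattice `𝓛* = {z : x·z ∈ ℤ for all x ∈ 𝓛}`. -/
def dualLattice (Γ : Subgroup (Isom n)) : AddSubgroup (Eucl n) where
  carrier := {z | ∀ x ∈ lattice Γ, ∃ k : ℤ, ⟪x, z⟫_ℝ = k}
  zero_mem' := fun x _ => ⟨0, by simp⟩
  add_mem' := by
    intro a b ha hb x hx
    obtain ⟨k, hk⟩ := ha x hx
    obtain ⟨l, hl⟩ := hb x hx
    exact ⟨k + l, by rw [inner_add_right, hk, hl]; push_cast; ring⟩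
  neg_mem' := by
    intro a ha x hx
    obtain ⟨k, hk⟩ := ha x hx
    exact ⟨-k, by rw [inner_neg_right, hk]; push_cast; ring⟩

theorem map_mem_lattice {Γ : Subgroup (Isom n)} {M : Eucl n ≃ₗᵢ[ℝ] Eucl n}
    (hM : M ∈ pointGroup Γ) {x : Eucl n} (hx : x ∈ lattice Γ) : M x ∈ lattice Γ := by
  obtain ⟨g, hg, rfl⟩ := hM
  obtain ⟨t, ht, htx⟩ := hx
  refine ⟨g * t * g⁻¹, Γ.mul_mem (Γ.mul_mem hg ht) (Γ.inv_mem hg), fun z => ?_⟩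
  have h1 : (g * t * g⁻¹) z = g (t (g⁻¹ z)) := rfl
  have h2 : g (g⁻¹ z) = z := by simp
  rw [h1, htx, isom_apply g, map_add, add_right_comm, ← isom_apply g, h2]
  rfl

theorem map_mem_dualLattice {Γ : Subgroup (Isom n)} {M : Eucl n ≃ₗᵢ[ℝ] Eucl n}
    (hM : M ∈ pointGroup Γ) {z : Eucl n} (hz : z ∈ dualLattice Γ) : M z ∈ dualLattice Γ := by
  intro x hx
  obtain ⟨k, hk⟩ := hz _ (map_mem_lattice ((pointGroup Γ).inv_mem hM) hx)
  refine ⟨k, ?_⟩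
  have h : M (M⁻¹ x) = x := M.apply_symm_apply x
  rw [← hk, ← M.inner_map_map (M⁻¹ x) z, h]

/-- The dual crystal group `Γ* = {[z, M] : z ∈ 𝓛*, M ∈ Π}`. -/
def dualCrystalGroup (Γ : Subgroup (Isom n)) : Subgroup (Isom n) where
  carrier := {g | linPart n g ∈ pointGroup Γ ∧ transPart g ∈ dualLattice Γ}
  one_mem' := ⟨by rw [map_one]; exact one_mem _, by
    simp only [transPart, AffineIsometryEquiv.coe_one, id, map_zero]
    exact zero_mem _⟩
  mul_mem' := by
    rintro a b ⟨ha, ha'⟩ ⟨hb, hb'⟩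
    refine ⟨by rw [map_mul]; exact mul_mem ha hb, ?_⟩
    have h : transPart (a * b) = (linPart n b)⁻¹ (transPart a) + transPart b := by
      apply (linPart n (a * b)).injective
      have h1 := isom_apply' (a * b) 0
      rw [zero_add] at h1
      rw [← h1]
      have h2 : (a * b) 0 = a (b 0) := rfl
      rw [h2, isom_apply' a, isom_apply' b, zero_add, map_mul]
      change linPart n a _ = linPart n a (linPart n b _)
      congr 1
      rw [map_add (linPart n b), add_comm]
      congr 1
      exact ((linPart n b).apply_symm_apply _).symm
    rw [h]
    exact add_mem (map_mem_dualLattice (inv_mem hb) ha') hb'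
  inv_mem' := by
    rintro a ⟨ha, ha'⟩
    refine ⟨by rw [map_inv]; exact inv_mem ha, ?_⟩
    have h : transPart a⁻¹ = -(linPart n a (transPart a)) := by
      apply (linPart n a⁻¹).injective
      have h1 := isom_apply' a⁻¹ 0
      rw [zero_add] at h1
      rw [← h1]
      apply a.injective
      have h2 : a (a⁻¹ 0) = 0 := by simp
      rw [h2, isom_apply' a, map_neg, map_inv]
      have h3 : (linPart n a)⁻¹ (linPart n a (transPart a)) = transPart a :=
        (linPart n a).symm_apply_apply _
      rw [h3, neg_add_cancel, map_zero]
    rw [h]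
    exact neg_mem (map_mem_dualLattice ha ha')

/-- A fundamental domain of a group `G` of isometries: a connected open set whose translates
under distinct elements of `G` are disjoint and whose closure has translates covering `ℝⁿ`. -/
structure IsFundamentalDomain (G : Subgroup (Isom n)) (R : Set (Eucl n)) : Prop where
  isOpen : IsOpen R
  disjoint : ∀ g ∈ G, ∀ h ∈ G, g ≠ h → Disjoint (g '' R) (h '' R)
  cover : ⋃ g ∈ G, g '' closure R = Set.univ
  connected : IsConnected R

/-- A fundamental set of `G`: it contains exactly one point of each orbit. -/
def IsFundamentalSet (G : Subgroup (Isom n)) (Ω : Set (Eucl n)) : Prop :=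
  ∀ x : Eucl n, ∃! y, y ∈ Ω ∧ ∃ g ∈ G, g x = y

/-- A cross-section `γ : Π → Γ`: `γ M = [x_M, M]` for each `M ∈ Π`, and `γ id = [0, id]`. -/
structure IsCrossSection (Γ : Subgroup (Isom n)) (γ : pointGroup Γ → Γ) : Prop where
  lin : ∀ M, linPart n (γ M).1 = M.1
  one : γ 1 = 1

/-! ### The crystallographic shift representation and the Fourier transform -/

/-- `L²(ℝⁿ)`. -/
abbrev L2 (n : ℕ) : Type := Lp (α := Eucl n) ℂ 2 volume

theorem measurePreserving_isom (g : Isom n) :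
    MeasurePreserving (fun x => g x) (volume : Measure (Eucl n)) volume := by
  have h := (measurePreserving_add_right (volume : Measure (Eucl n)) (g 0)).comp
    g.linearIsometryEquiv.measurePreserving
  have e : (fun x => g x) = (fun x => x + g 0) ∘ g.linearIsometryEquiv := by
    funext x
    exact isom_apply g x
  rw [e]
  exact h

/-- The operator `π(g)` on `L²(ℝⁿ)`: `(π(g) f)(y) = f (g⁻¹ y)`. -/
def shift (g : Isom n) : L2 n →ₗᵢ[ℂ] L2 n :=
  Lp.compMeasurePreservingₗᵢ ℂ (fun y => g⁻¹ y) (measurePreserving_isom g⁻¹)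

/-- Invariance of a subspace of `L²(ℝⁿ)` under `π(g)` for all `g ∈ Γ`. -/
def IsShiftInvariant (Γ : Subgroup (Isom n)) (V : Submodule ℂ (L2 n)) : Prop :=
  ∀ g ∈ Γ, ∀ f ∈ V, shift g f ∈ V

/-- The Plancherel transform extending `𝓕 f (χ_ω) = ∫ f x * exp (2πi ω·x) dx`.  The sign in the
exponent is `+`, so in Mathlib's convention this is the inverse Fourier transform on `L²`. -/
def plancherel (n : ℕ) : L2 n ≃ₗᵢ[ℂ] L2 n := (Lp.fourierTransformₗᵢ (Eucl n) ℂ).symm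

/-! ### `L²(Ω; l²(Π) ⊗ l²(𝓛*))` and direct integrals of subspaces -/

/-- `l²(Π)`. -/
abbrev ellPoint (Γ : Subgroup (Isom n)) : Type := lp (fun _ : pointGroup Γ => ℂ) 2

/-- `l²(𝓛*)`. -/
abbrev ellDual (Γ : Subgroup (Isom n)) : Type := lp (fun _ : dualLattice Γ => ℂ) 2

/-- The Hilbert space tensor product `l²(Π) ⊗ l²(𝓛*)`, realized as `l²(Π × 𝓛*)`. -/
abbrev Fiber (Γ : Subgroup (Isom n)) : Type :=
  lp (fun _ : pointGroup Γ × dualLattice Γ => ℂ) 2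

/-- The elementary tensor `ζ ⊗ β ∈ l²(Π) ⊗ l²(𝓛*)`, `(ζ ⊗ β)(M, z) = ζ(M) β(z)`. -/
def tensor {Γ : Subgroup (Isom n)} (ζ : ellPoint Γ) (β : ellDual Γ) : Fiber Γ :=
  ⟨fun p => ζ p.1 * β p.2, by
    have h2 : (0 : ℝ) < (2 : ℝ≥0∞).toReal := by norm_num
    have h1 := (memℓp_gen_iff h2).1 ζ.2
    have h3 := (memℓp_gen_iff h2).1 β.2
    refine (memℓp_gen_iff h2).2 ?_
    have h := h1.mul_of_nonneg h3 (fun _ => by positivity) (fun _ => by positivity)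
    refine h.congr fun p => ?_
    rw [norm_mul, Real.mul_rpow (norm_nonneg _) (norm_nonneg _)]⟩

/-- `l²(Π) ⊗ F` for a subspace `F ⊆ l²(𝓛*)`: the closed linear span of the elementary
tensors `ζ ⊗ β` with `β ∈ F`. -/
def tensorSubspace {Γ : Subgroup (Isom n)} (F : Submodule ℂ (ellDual Γ)) :
    Submodule ℂ (Fiber Γ) :=
  (Submodule.span ℂ {v | ∃ ζ : ellPoint Γ, ∃ β ∈ F, v = tensor ζ β}).topologicalClosure

/-- `L²(Ω; l²(Π) ⊗ l²(𝓛*))` with respect to Lebesgue measure on `Ω`. -/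
abbrev L2Fiber (Γ : Subgroup (Isom n)) (Ω : Set (Eucl n)) : Type :=
  Lp (Fiber Γ) 2 ((volume : Measure (Eucl n)).restrict Ω)

/-- A measurable range function on `Ω`: a family of closed subspaces `W ω` of
`l²(Π) ⊗ l²(𝓛*)`, `ω ∈ Ω`, such that `ω ↦ ⟨P_{W ω} a, b⟩` is Lebesgue measurable for all `a`
and `b`, where `P_{W ω}` is the orthogonal projection onto `W ω`.  (The closure in the second
field is `W ω` itself.  Values of `W` outside `Ω` are irrelevant.  Lebesgue measurability is
`AEMeasurable`.) -/
structure IsMeasurableRangeFunction {Γ : Subgroup (Isom n)} (Ω : Set (Eucl n))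
    (W : Eucl n → Submodule ℂ (Fiber Γ)) : Prop where
  closed : ∀ ω ∈ Ω, IsClosed (W ω : Set (Fiber Γ))
  measurable : ∀ a b : Fiber Γ,
    AEMeasurable (fun ω => ⟪(W ω).topologicalClosure.starProjection a, b⟫_ℂ)
      ((volume : Measure (Eucl n)).restrict Ω)

/-- The direct integral `∫_Ω^⊕ W_ω dω` as a subspace of `L²(Ω; l²(Π) ⊗ l²(𝓛*))`. -/
def directIntegral {Γ : Subgroup (Isom n)} (Ω : Set (Eucl n))
    (W : Eucl n → Submodule ℂ (Fiber Γ)) : Set (L2Fiber Γ Ω) :=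
  {f | ∀ᵐ ω ∂((volume : Measure (Eucl n)).restrict Ω), f ω ∈ W ω}

/-! ### The components of the intertwiner -/

/-- The action of `M⁻¹`, `M ∈ Π`, on `𝓛*`. -/
def invAct {Γ : Subgroup (Isom n)} (M : pointGroup Γ) (z : dualLattice Γ) : dualLattice Γ :=
  ⟨M.1⁻¹ z.1, map_mem_dualLattice (inv_mem M.2) z.2⟩

/-- `I_{[w, N]}(f)(ω) = ⟨f(ω), δ_N ⊗ δ_w⟩`, the `(N, w)` coordinate of `f(ω)`. -/
def coeff {Γ : Subgroup (Isom n)} {Ω : Set (Eucl n)} (w : dualLattice Γ) (N : pointGroup Γ)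
    (f : L2Fiber Γ Ω) (ω : Eucl n) : ℂ := f ω (N, w)

/-- `p′_{a, [z, M]}(y) = a (M⁻¹ (y - z))` if `M⁻¹ (y - z) ∈ Ω`, and `0` otherwise. -/
def pPrime {Γ : Subgroup (Isom n)} (Ω : Set (Eucl n)) (a : Eucl n → ℂ) (z : dualLattice Γ)
    (M : pointGroup Γ) (y : Eucl n) : ℂ := Ω.indicator a (M.1⁻¹ (y - z.1))

/-- The character value `χ_ω(x) = exp (2πi ω·x)`. -/
def chi (ω x : Eucl n) : ℂ := Complex.exp (2 * Real.pi * Complex.I * (⟪ω, x⟫_ℝ : ℝ))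

/-- `(X(M) g)(y) = χ_{M⁻¹ y}(x_M) g(y)`, where `γ M = [x_M, M]`. -/
def mulX {Γ : Subgroup (Isom n)} (γ : pointGroup Γ → Γ) (M : pointGroup Γ) (g : Eucl n → ℂ)
    (y : Eucl n) : ℂ := chi (M.1⁻¹ y) (transPart (γ M).1) * g y

/-- `g = ∑⊕_{[z, M] ∈ Γ*} X(M) p′_{I_{[M⁻¹z, M]}(f), [z, M]}`: the summands belong to `L²`, they
are pairwise orthogonal, and their unordered sum converges to `g` in `L²`. -/
def IsOrthSum {Γ : Subgroup (Isom n)} {Ω : Set (Eucl n)} (γ : pointGroup Γ → Γ)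
    (f : L2Fiber Γ Ω) (g : L2 n) : Prop :=
  ∃ c : dualLattice Γ × pointGroup Γ → L2 n,
    (∀ p, c p =ᵐ[volume] mulX γ p.2 (pPrime Ω (coeff (invAct p.2 p.1) p.2 f) p.1 p.2)) ∧
    (∀ p q, p ≠ q → ⟪c p, c q⟫_ℂ = 0) ∧
    HasSum c g

end Crystal

end

noncomputable section

namespace Crystal

/-! ### Separation of complex densities by unimodular functions -/

section Uniqueness

variable {X I : Type*} [MeasurableSpace X] {μ : Measure X}

/-! The cells of Γ*, the images of Ω under the maps y ↦ N(y + w), tile ℝⁿ up to a null set: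
convexity makes the frontier of R null, so Ω and R agree almost everywhere. Splitting a function
into its restrictions to the cells, pulling each back to Ω and removing the character attached to
γ(N) gives the unitary of (a). It is built by matching two Hilbert sum decompositions,
`isHilbertSum_coordEmbed` and `isHilbertSum_embedCell`; `isOrthSum_iff` identifies its inverse with
the explicit sum.

For (b), the Plancherel transform turns π(g), with linear part L, into rotation by L followed by
multiplication by y ↦ χ_y(g 0) (`plancherel_shift`). This carries the cell of (N, w) to that of (LN,
w). Thanks to the factors X(M), the scalar left over on the target cell is a character evaluated at
a vector of 𝓛 (`cocycle_mem_lattice`), hence does not depend on w. So π(g) permutes the Π-slices of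
the fibers up to unimodular scalars (`mulOp_periodicSet_dualShift`), which preserves every l²(Π) ⊗
F_ω (`directIntegral_invariant`).

Conversely, the translations in Γ act as multiplication by the characters of 𝓛. These separate
points modulo 𝓛*, so an invariant closed subspace is stable under cutting down to sets ME + 𝓛* with
E ⊆ R measurable (`IsDualShiftInvariant.mulOp_periodicSet_mem`). Such a cut isolates the slice M
over E. Varying E and the group element shows that every slice of a function in the subspace is
orthogonal, at almost every ω, to every slice of a function in its complement
(`ae_inner_slice_eq_zero`). Let F_ω be the closed span of the slices at ω of a dense sequence. The
subspace takes values in l²(Π) ⊗ F_ω and its complement in the orthogonal complements of these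
fibers, so the subspace is the whole direct integral, and its projection acts fiberwise, which gives
measurability. -/

/-- The unit circle as a subtype of `ℂ`. -/
abbrev UnitCircle : Type := Metric.sphere (0 : ℂ) 1

/-- The coordinate functions on a product of circles. -/
def circleCoord (i : I) : BoundedContinuousFunction (I → UnitCircle) ℂ :=
  BoundedContinuousFunction.ofNormedAddCommGroup (fun k => (k i : ℂ)) (by fun_prop) 1
    (fun k => by simp)

/-- The star subalgebra of trigonometric polynomials on a product of circles. -/
def trigPoly (I : Type*) : StarSubalgebra ℂ (BoundedContinuousFunction (I → UnitCircle) ℂ) :=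
  StarAlgebra.adjoin ℂ (Set.range circleCoord)

theorem trigPoly_separatesPoints :
    ((trigPoly I).map (BoundedContinuousFunction.toContinuousMapStarₐ ℂ)).SeparatesPoints := by
  intro x y hxy
  obtain ⟨i, hi⟩ := Function.ne_iff.1 hxy
  refine ⟨fun k => (k i : ℂ), ⟨_, ⟨circleCoord i, StarAlgebra.subset_adjoin ℂ _ ⟨i, rfl⟩, rfl⟩,
    rfl⟩, fun h => hi (Subtype.ext h)⟩

/-- An adjoined algebra is the linear span of the monomials in its generators, so linear conditions
need checking only on products of coordinates and conjugate coordinates. -/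
theorem trigPoly_induction {p : BoundedContinuousFunction (I → UnitCircle) ℂ → Prop}
    (zero : p 0) (add : ∀ f g, p f → p g → p (f + g)) (smul : ∀ (c : ℂ) f, p f → p (c • f))
    (mono : ∀ f ∈ Submonoid.closure
      (Set.range (circleCoord (I := I)) ∪ star (Set.range circleCoord)), p f)
    {f : BoundedContinuousFunction (I → UnitCircle) ℂ} (hf : f ∈ trigPoly I) : p f := by
  have h : f ∈ Algebra.adjoin ℂ (Set.range (circleCoord (I := I)) ∪ star (Set.range circleCoord)) :=
    hf
  rw [← Subalgebra.mem_toSubmodule, Algebra.adjoin_eq_span] at h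
  clear hf
  induction h using Submodule.span_induction with
  | mem x hx => exact mono x hx
  | zero => exact zero
  | add f g _ _ h1 h2 => exact add f g h1 h2
  | smul c f _ h1 => exact smul c f h1

/-- The map into a product of circles given by a family of unimodular functions. -/
def circleMap (e : I → X → ℂ) (h : ∀ i x, ‖e i x‖ = 1) (x : X) (i : I) : UnitCircle :=
  ⟨e i x, mem_sphere_zero_iff_norm.2 (h i x)⟩

/-- A family of measurable unimodular functions that is a group under multiplication. -/
structure IsCircleGroup (e : I → X → ℂ) : Prop where
  norm_eq : ∀ i x, ‖e i x‖ = 1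
  measurable : ∀ i, Measurable (e i)
  one : ∃ i, ∀ x, e i x = 1
  mul : ∀ i j, ∃ k, ∀ x, e k x = e i x * e j x
  inv : ∀ i, ∃ k, ∀ x, e k x = (e i x)⁻¹

/-- On the unit circle conjugation is inversion, so the group property collapses the pullback of a
monomial to a single member of the family. -/
theorem IsCircleGroup.exists_comp_eq {e : I → X → ℂ} (he : IsCircleGroup e)
    {f : BoundedContinuousFunction (I → UnitCircle) ℂ}
    (hf : f ∈ Submonoid.closure (Set.range (circleCoord (I := I)) ∪ star (Set.range circleCoord))) :
    ∃ k, ∀ x, f (circleMap e he.norm_eq x) = e k x := by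
  induction hf using Submonoid.closure_induction with
  | mem f hf =>
    rcases hf with ⟨i, rfl⟩ | ⟨i, hi⟩
    · exact ⟨i, fun x => rfl⟩
    · obtain ⟨k, hk⟩ := he.inv i
      refine ⟨k, fun x => ?_⟩
      rw [hk, Complex.inv_eq_conj (he.norm_eq i x), ← star_star f, ← hi]
      rfl
  | one =>
    obtain ⟨k, hk⟩ := he.one
    exact ⟨k, fun x => by simp [hk]⟩
  | mul f g _ _ hf hg =>
    obtain ⟨i, hi⟩ := hf
    obtain ⟨j, hj⟩ := hg
    obtain ⟨k, hk⟩ := he.mul i j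
    exact ⟨k, fun x => by simp [hk, hi, hj]⟩

theorem IsCircleGroup.measurable_pi {e : I → X → ℂ} (he : IsCircleGroup e) :
    Measurable (circleMap e he.norm_eq) :=
  measurable_pi_lambda _ fun i => (he.measurable i).subtype_mk

theorem integrable_smul_comp_circle {e : I → X → ℂ} [Countable I] (he : IsCircleGroup e)
    {q : X → ℝ} (hq : Integrable q μ) (g : BoundedContinuousFunction (I → UnitCircle) ℂ) :
    Integrable (fun x => q x • g (circleMap e he.norm_eq x)) μ := by
  refine hq.smul_bdd (C := ‖g‖) ?_ ?_
  · exact (g.continuous.measurable.comp he.measurable_pi).aestronglyMeasurable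
  · exact Filter.Eventually.of_forall fun x => g.norm_coe_le_norm _

/-- The positive and negative parts of q define finite measures whose images on the product of
circles have equal integrals against all trigonometric polynomials. A countable product of circles
is Polish, so a separating star subalgebra determines the measure: the two images coincide. -/
theorem IsCircleGroup.setIntegral_real_eq_zero [Countable I] {e : I → X → ℂ}
    (he : IsCircleGroup e) {q : X → ℝ} (hq : Integrable q μ)
    (h0 : ∀ i, ∫ x, q x • e i x ∂μ = 0) {A : Set (I → ℂ)} (hA : MeasurableSet A) :
    ∫ x in (fun x i => e i x) ⁻¹' A, q x ∂μ = 0 := by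
  have hΦ := he.measurable_pi
  let Φ : X → I → UnitCircle := circleMap e he.norm_eq
  have fin1 : IsFiniteMeasure (μ.withDensity fun x => ENNReal.ofReal (q x)) :=
    isFiniteMeasure_withDensity_ofReal hq.2
  have fin2 : IsFiniteMeasure (μ.withDensity fun x => ENNReal.ofReal (-q x)) :=
    isFiniteMeasure_withDensity_ofReal hq.neg.2
  have key : (μ.withDensity fun x => ENNReal.ofReal (q x)).map Φ =
      (μ.withDensity fun x => ENNReal.ofReal (-q x)).map Φ := by
    refine ext_of_forall_mem_subalgebra_integral_eq_of_polish (𝕜 := ℂ) (A := trigPoly I)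
      trigPoly_separatesPoints fun g hg => ?_
    have hvan : ∫ x, q x • g (Φ x) ∂μ = 0 := by
      refine trigPoly_induction (p := fun g => ∫ x, q x • g (Φ x) ∂μ = 0) ?_ ?_ ?_ ?_ hg
      · simp
      · intro f g hf hg
        simp only [BoundedContinuousFunction.add_apply, smul_add]
        rw [integral_add (integrable_smul_comp_circle he hq f)
          (integrable_smul_comp_circle he hq g), hf, hg, add_zero]
      · intro c f hf
        simp only [BoundedContinuousFunction.smul_apply]
        simp_rw [smul_comm _ c]
        rw [integral_smul, hf, smul_zero]
      · intro f hf
        obtain ⟨k, hk⟩ := he.exists_comp_eq hf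
        simp only [Φ, hk]
        exact h0 k
    -- `ENNReal.ofReal` truncates negative values to zero, so using it with q and with -q yields the
    -- positive and negative parts of q.
    have pos {p : X → ℝ} (hp : Integrable p μ) :
        ∫ k, g k ∂((μ.withDensity fun x => ENNReal.ofReal (p x)).map Φ) =
          ∫ x, (max (p x) 0) • g (Φ x) ∂μ := by
      rw [integral_map hΦ.aemeasurable g.continuous.aestronglyMeasurable,
        integral_withDensity_eq_integral_toReal_smul₀ hp.1.aemeasurable.ennreal_ofReal
          (Filter.Eventually.of_forall fun x => ENNReal.ofReal_lt_top)]
      simp only [ENNReal.toReal_ofReal']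
      rfl
    rw [pos hq, pos (p := fun x => -q x) hq.neg, ← sub_eq_zero, ← integral_sub
      (integrable_smul_comp_circle he hq.pos_part g)
      (integrable_smul_comp_circle he hq.neg_part g)]
    refine Eq.trans ?_ hvan
    refine integral_congr_ae (Filter.Eventually.of_forall fun x => ?_)
    simp only [← sub_smul]
    congr 1
    exact posPart_sub_negPart (q x)
  let B : Set (I → UnitCircle) := (fun k i => (k i : ℂ)) ⁻¹' A
  have hB : MeasurableSet B :=
    (measurable_pi_lambda _ fun i => measurable_subtype_coe.comp (measurable_pi_apply i)) hA
  have hm : MeasurableSet (Φ ⁻¹' B) := hΦ hB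
  have h2 : (μ.withDensity fun x => ENNReal.ofReal (q x)) (Φ ⁻¹' B) =
      (μ.withDensity fun x => ENNReal.ofReal (-q x)) (Φ ⁻¹' B) := by
    rw [← Measure.map_apply hΦ hB, key, Measure.map_apply hΦ hB]
  rw [withDensity_apply _ hm, withDensity_apply _ hm] at h2
  change ∫ x in Φ ⁻¹' B, q x ∂μ = 0
  rw [integral_eq_lintegral_pos_part_sub_lintegral_neg_part hq.integrableOn]
  exact sub_eq_zero.2 (congrArg ENNReal.toReal h2)

/-- If an integrable density is orthogonal to a countable group of unimodular functions, its
integral over every set generated by these functions vanishes. -/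
theorem IsCircleGroup.setIntegral_eq_zero [Countable I] {e : I → X → ℂ}
    (he : IsCircleGroup e) {Q : X → ℂ} (hQ : Integrable Q μ)
    (h0 : ∀ i, ∫ x, Q x * e i x ∂μ = 0) {A : Set (I → ℂ)} (hA : MeasurableSet A) :
    ∫ x in (fun x i => e i x) ⁻¹' A, Q x ∂μ = 0 := by
  have int1 (i : I) {f : X → ℂ} (hf : Integrable f μ) : Integrable (fun x => f x * e i x) μ := by
    refine hf.mul_bdd (c := 1) ?_ (Filter.Eventually.of_forall fun x => (he.norm_eq i x).le)
    exact (he.measurable i).aestronglyMeasurable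
  have hQ' : Integrable (fun x => (starRingEnd ℂ) (Q x)) μ :=
    Complex.conjCLE.toContinuousLinearMap.integrable_comp hQ
  -- Conjugating the hypothesis for the inverse of e i gives the same orthogonality for the
  -- conjugate of Q, hence for its real and imaginary parts.
  have h0' (i : I) : ∫ x, (starRingEnd ℂ) (Q x) * e i x ∂μ = 0 := by
    obtain ⟨k, hk⟩ := he.inv i
    have h := congrArg (starRingEnd ℂ) (h0 k)
    rw [← integral_conj, map_zero] at h
    rw [← h]
    refine integral_congr_ae (Filter.Eventually.of_forall fun x => ?_)
    simp [hk, Complex.inv_eq_conj (he.norm_eq i x)]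
  have hre (i : I) : ∫ x, (Q x).re • e i x ∂μ = 0 := by
    have h : ∀ x, (Q x).re • e i x =
        (2⁻¹ : ℂ) * (Q x * e i x + (starRingEnd ℂ) (Q x) * e i x) := by
      intro x
      rw [← add_mul, Complex.add_conj, Complex.real_smul]
      push_cast
      ring
    simp_rw [h]
    rw [integral_const_mul, integral_add (int1 i hQ) (int1 i hQ'), h0, h0']
    simp
  have him (i : I) : ∫ x, (Q x).im • e i x ∂μ = 0 := by
    have h : ∀ x, (Q x).im • e i x =
        (-2⁻¹ * Complex.I : ℂ) * (Q x * e i x - (starRingEnd ℂ) (Q x) * e i x) := by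
      intro x
      rw [← sub_mul, Complex.sub_conj, Complex.real_smul]
      push_cast
      linear_combination ((Q x).im * e i x) * Complex.I_sq
    simp_rw [h]
    rw [integral_const_mul, integral_sub (int1 i hQ) (int1 i hQ'), h0, h0']
    simp
  have h1 := he.setIntegral_real_eq_zero hQ.re hre hA
  have h2 := he.setIntegral_real_eq_zero hQ.im him hA
  rw [← integral_re_add_im hQ.integrableOn]
  simp only [RCLike.re_to_complex, RCLike.im_to_complex] at *
  rw [h1, h2]
  simp

end Uniqueness

/-! ### Operators on `L²` spaces -/

section Operators

variable {X : Type*} [MeasurableSpace X] {μ : Measure X}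
  {E : Type*} [NormedAddCommGroup E] [NormedSpace ℂ E]

/-- Multiplication by an essentially bounded function. -/
def mulOp (φ : X → ℂ) (hφ : MemLp φ ∞ μ) : Lp E 2 μ →L[ℂ] Lp E 2 μ :=
  (ContinuousLinearMap.lsmul ℂ ℂ).holderL μ ∞ 2 2 hφ.toLp

theorem coeFn_mulOp (φ : X → ℂ) (hφ : MemLp φ ∞ μ) (f : Lp E 2 μ) :
    mulOp φ hφ f =ᵐ[μ] fun x => φ x • f x := by
  have h := (ContinuousLinearMap.lsmul ℂ ℂ (E := E)).coeFn_holder (r := 2) hφ.toLp f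
  filter_upwards [h, hφ.coeFn_toLp] with x h1 h2
  change ((ContinuousLinearMap.lsmul ℂ ℂ).holder 2 hφ.toLp f : Lp E 2 μ) x = _
  rw [h1, h2]
  rfl

theorem memLp_top_of_norm_le {φ : X → ℂ} (hm : AEStronglyMeasurable φ μ)
    {C : ℝ} (h : ∀ x, ‖φ x‖ ≤ C) : MemLp φ ∞ μ :=
  memLp_top_of_bound hm C (Filter.Eventually.of_forall h)

/-- Multiplication by a unimodular function. -/
def mulIsom (φ : X → ℂ) (hφ : MemLp φ ∞ μ) (h1 : ∀ x, ‖φ x‖ = 1) : Lp E 2 μ →ₗᵢ[ℂ] Lp E 2 μ where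
  toLinearMap := (mulOp φ hφ).toLinearMap
  norm_map' f := by
    change ‖mulOp φ hφ f‖ = ‖f‖
    rw [Lp.norm_def, Lp.norm_def]
    congr 1
    refine eLpNorm_congr_norm_ae ?_
    filter_upwards [coeFn_mulOp φ hφ f] with x hx
    rw [hx, norm_smul, h1, one_mul]

theorem coeFn_mulIsom (φ : X → ℂ) (hφ : MemLp φ ∞ μ) (h1 : ∀ x, ‖φ x‖ = 1) (f : Lp E 2 μ) :
    mulIsom φ hφ h1 f =ᵐ[μ] fun x => φ x • f x := coeFn_mulOp φ hφ f

-- Ω lies between an open set and its closure and need not be Borel, so extension by zero is set up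
-- for null measurable sets, by passing to a measurable set equal almost everywhere.
omit [NormedSpace ℂ E] in
theorem eLpNorm_indicator_restrict₀ {s : Set X} (hs : NullMeasurableSet s μ) (f : X → E) :
    eLpNorm (s.indicator f) 2 μ = eLpNorm f 2 (μ.restrict s) := by
  obtain ⟨t, -, ht, hst⟩ := hs.exists_measurable_superset_ae_eq
  rw [← Measure.restrict_congr_set hst, ← eLpNorm_indicator_eq_eLpNorm_restrict ht]
  exact eLpNorm_congr_ae (indicator_ae_eq_of_ae_eq_set hst.symm)

omit [NormedSpace ℂ E] in
theorem memLp_indicator₀ {s : Set X} (hs : NullMeasurableSet s μ) {f : X → E}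
    (hf : MemLp f 2 (μ.restrict s)) : MemLp (s.indicator f) 2 μ :=
  ⟨(aestronglyMeasurable_indicator_iff₀ hs).2 hf.1,
    by rw [eLpNorm_indicator_restrict₀ hs]; exact hf.2⟩

omit [NormedSpace ℂ E] in
theorem indicator_ae_eq_of_restrict {s : Set X} (hs : NullMeasurableSet s μ) {f g : X → E}
    (h : f =ᵐ[μ.restrict s] g) : s.indicator f =ᵐ[μ] s.indicator g := by
  filter_upwards [(ae_restrict_iff'₀ hs).1 h] with x hx
  by_cases hxs : x ∈ s
  · simp [hxs, hx hxs]
  · simp [hxs]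

/-- Extension by zero, as an isometry from `L²(s)`. -/
def extendZero (s : Set X) (hs : NullMeasurableSet s μ) :
    Lp E 2 (μ.restrict s) →ₗᵢ[ℂ] Lp E 2 μ where
  toFun f := (memLp_indicator₀ hs (Lp.memLp f)).toLp
  map_add' f g := by
    rw [← MemLp.toLp_add]
    refine MemLp.toLp_congr _ _ ?_
    rw [← Set.indicator_add']
    exact indicator_ae_eq_of_restrict hs (Lp.coeFn_add f g)
  map_smul' c f := by
    rw [RingHom.id_apply, ← MemLp.toLp_const_smul]
    refine MemLp.toLp_congr _ _ ?_
    rw [show c • s.indicator (f : X → E) = s.indicator (c • (f : X → E)) from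
      (Set.indicator_const_smul s c _).symm]
    exact indicator_ae_eq_of_restrict hs (Lp.coeFn_smul c f)
  norm_map' f := by
    change ‖(memLp_indicator₀ hs (Lp.memLp f)).toLp‖ = _
    rw [Lp.norm_toLp, eLpNorm_indicator_restrict₀ hs, Lp.norm_def]

theorem coeFn_extendZero (s : Set X) (hs : NullMeasurableSet s μ) (f : Lp E 2 (μ.restrict s)) :
    extendZero s hs f =ᵐ[μ] s.indicator f := (memLp_indicator₀ hs (Lp.memLp f)).coeFn_toLp

/-- The isometry `a ↦ a e` from scalar functions to functions with values in the line of the unit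
vector `e`. -/
def smulVec (e : E) (he : ‖e‖ = 1) : Lp ℂ 2 μ →ₗᵢ[ℂ] Lp E 2 μ where
  toLinearMap := ((ContinuousLinearMap.toSpanSingleton ℂ e).compLpL 2 μ).toLinearMap
  norm_map' f := by
    change ‖(ContinuousLinearMap.toSpanSingleton ℂ e).compLpL 2 μ f‖ = ‖f‖
    rw [Lp.norm_def, Lp.norm_def]
    congr 1
    refine eLpNorm_congr_norm_ae ?_
    filter_upwards [(ContinuousLinearMap.toSpanSingleton ℂ e).coeFn_compLpL f] with x hx
    rw [hx, ContinuousLinearMap.toSpanSingleton_apply, norm_smul, he, mul_one]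

theorem coeFn_smulVec (e : E) (he : ‖e‖ = 1) (f : Lp ℂ 2 μ) :
    smulVec e he f =ᵐ[μ] fun x => f x • e :=
  (ContinuousLinearMap.toSpanSingleton ℂ e).coeFn_compLpL f

end Operators

variable {n : ℕ}

/-! ### Characters -/

theorem chi_add_left (ω ω' x : Eucl n) : chi (ω + ω') x = chi ω x * chi ω' x := by
  rw [chi, chi, chi, ← Complex.exp_add, inner_add_left]
  push_cast
  ring_nf

theorem chi_add_right (ω x x' : Eucl n) : chi ω (x + x') = chi ω x * chi ω x' := by
  rw [chi, chi, chi, ← Complex.exp_add, inner_add_right]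
  push_cast
  ring_nf

@[simp] theorem chi_zero_right (ω : Eucl n) : chi ω 0 = 1 := by simp [chi]

theorem chi_neg_right (ω x : Eucl n) : chi ω (-x) = (chi ω x)⁻¹ := by
  rw [chi, chi, ← Complex.exp_neg, inner_neg_right]
  push_cast
  ring_nf

@[simp] theorem norm_chi (ω x : Eucl n) : ‖chi ω x‖ = 1 := by
  rw [chi, Complex.norm_exp]
  simp

theorem chi_ne_zero (ω x : Eucl n) : chi ω x ≠ 0 := Complex.exp_ne_zero _

theorem continuous_chi_left (x : Eucl n) : Continuous (fun ω => chi ω x) := by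
  unfold chi
  fun_prop

theorem chi_map_map (N : Eucl n ≃ₗᵢ[ℝ] Eucl n) (ω x : Eucl n) : chi (N ω) (N x) = chi ω x := by
  rw [chi, chi, N.inner_map_map]

theorem apply_inv_apply (N : Eucl n ≃ₗᵢ[ℝ] Eucl n) (y : Eucl n) : N (N⁻¹ y) = y :=
  N.apply_symm_apply y

theorem inv_apply_apply (N : Eucl n ≃ₗᵢ[ℝ] Eucl n) (y : Eucl n) : N⁻¹ (N y) = y :=
  N.symm_apply_apply y

theorem mul_apply' (N M : Eucl n ≃ₗᵢ[ℝ] Eucl n) (y : Eucl n) : (N * M) y = N (M y) := rfl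

variable {Γ : Subgroup (Isom n)}

theorem zero_mem_lattice : (0 : Eucl n) ∈ lattice Γ := ⟨1, Γ.one_mem, fun z => by simp⟩

theorem add_mem_lattice {x y : Eucl n} (hx : x ∈ lattice Γ) (hy : y ∈ lattice Γ) :
    x + y ∈ lattice Γ := by
  obtain ⟨g, hg, hgx⟩ := hx
  obtain ⟨h, hh, hhy⟩ := hy
  refine ⟨h * g, Γ.mul_mem hh hg, fun z => ?_⟩
  rw [AffineIsometryEquiv.coe_mul, Function.comp_apply, hgx, hhy, add_assoc]

theorem neg_mem_lattice {x : Eucl n} (hx : x ∈ lattice Γ) : -x ∈ lattice Γ := by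
  obtain ⟨g, hg, hgx⟩ := hx
  refine ⟨g⁻¹, Γ.inv_mem hg, fun z => g.injective ?_⟩
  have h : g (g⁻¹ z) = z := g.apply_symm_apply z
  rw [h, hgx]
  simp

theorem chi_eq_one {w x : Eucl n} (hw : w ∈ dualLattice Γ) (hx : x ∈ lattice Γ) :
    chi w x = 1 := by
  obtain ⟨k, hk⟩ := hw x hx
  rw [chi, real_inner_comm, hk, Complex.exp_eq_one_iff]
  exact ⟨k, by push_cast; ring⟩

theorem sub_mem_dualLattice_of_chi_eq {ω ω' : Eucl n}
    (h : ∀ x ∈ lattice Γ, chi ω x = chi ω' x) : ω - ω' ∈ dualLattice Γ := by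
  intro x hx
  have h1 : chi (ω - ω') x = 1 := by
    have h2 : chi ω' x * chi (ω - ω') x = chi ω' x := by
      rw [← chi_add_left, add_sub_cancel, h x hx]
    exact mul_left_cancel₀ (chi_ne_zero ω' x) (by rw [h2, mul_one])
  rw [chi, Complex.exp_eq_one_iff] at h1
  obtain ⟨k, hk⟩ := h1
  refine ⟨k, ?_⟩
  rw [real_inner_comm]
  have h3 : ((⟪ω - ω', x⟫_ℝ : ℝ) : ℂ) = ((k : ℝ) : ℂ) := by
    have hpi : (2 * Real.pi * Complex.I : ℂ) ≠ 0 := Complex.two_pi_I_ne_zero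
    refine mul_left_cancel₀ hpi ?_
    rw [hk]
    push_cast
    ring
  exact_mod_cast h3

theorem isCircleGroup_chi :
    IsCircleGroup (fun (x : lattice Γ) (y : Eucl n) => chi y x) where
  norm_eq _ _ := norm_chi _ _
  measurable _ := (continuous_chi_left _).measurable
  one := ⟨⟨0, zero_mem_lattice⟩, fun _ => chi_zero_right _⟩
  mul x y := ⟨⟨x + y, add_mem_lattice x.2 y.2⟩, fun _ => chi_add_right _ _ _⟩
  inv x := ⟨⟨-x, neg_mem_lattice x.2⟩, fun _ => chi_neg_right _ _⟩

/-- The compact-open topology on C(ℝⁿ, ℝⁿ) is second countable, and a discrete second countable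
space is countable. -/
theorem IsCrystalGroup.countable (hΓ : IsCrystalGroup Γ) : Countable Γ := by
  have h := hΓ.discrete
  have h2 : @SecondCountableTopology Γ (TopologicalSpace.induced
      (fun g : Γ => (⟨fun x => g.1 x, g.1.continuous⟩ : C(Eucl n, Eucl n))) inferInstance) :=
    TopologicalSpace.secondCountableTopology_induced _ _ _
  rw [h] at h2
  let : TopologicalSpace Γ := ⊥
  have : DiscreteTopology Γ := ⟨rfl⟩
  have : SecondCountableTopology Γ := h2
  exact countable_of_Lindelof_of_discrete

/-- Countability makes the product of circles indexed by 𝓛 Polish, as the separation argument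
requires. -/
theorem IsCrystalGroup.countable_lattice (hΓ : IsCrystalGroup Γ) : Countable (lattice Γ) := by
  have := hΓ.countable
  choose g hg hgx using fun x : lattice Γ => x.2
  refine Function.Injective.countable (f := fun x : lattice Γ => (⟨g x, hg x⟩ : Γ))
    fun x y hxy => Subtype.ext ?_
  have h1 := hgx x 0
  have h2 := hgx y 0
  have h3 : g x = g y := congrArg Subtype.val hxy
  rw [h3, h2, zero_add, zero_add] at h1
  exact h1.symm

/-! ### The dual crystal group and its fundamental domain -/

/-- The isometry `[w, N]`, `y ↦ N (y + w)`, of the dual crystal group. -/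
def dualIsom (p : pointGroup Γ × dualLattice Γ) : Isom n :=
  p.1.1.toAffineIsometryEquiv * AffineIsometryEquiv.vaddConst ℝ p.2.1

theorem dualIsom_apply (p : pointGroup Γ × dualLattice Γ) (y : Eucl n) :
    dualIsom p y = p.1.1 (y + p.2.1) := rfl

theorem dualIsom_inv_apply (p : pointGroup Γ × dualLattice Γ) (y : Eucl n) :
    (dualIsom p)⁻¹ y = p.1.1⁻¹ y - p.2.1 := by
  apply (dualIsom p).injective
  have h : dualIsom p ((dualIsom p)⁻¹ y) = y := (dualIsom p).apply_symm_apply y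
  rw [h, dualIsom_apply, sub_add_cancel, apply_inv_apply]

theorem dualIsom_apply_inv_apply (p : pointGroup Γ × dualLattice Γ) (y : Eucl n) :
    dualIsom p ((dualIsom p)⁻¹ y) = y := (dualIsom p).apply_symm_apply y

theorem linPart_dualIsom (p : pointGroup Γ × dualLattice Γ) : linPart n (dualIsom p) = p.1.1 := by
  ext y
  have h1 := isom_apply (dualIsom p) y
  rw [dualIsom_apply, dualIsom_apply, map_add, zero_add] at h1
  rw [add_right_cancel h1]
  rfl

theorem transPart_dualIsom (p : pointGroup Γ × dualLattice Γ) : transPart (dualIsom p) = p.2.1 := by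
  have h : transPart (dualIsom p) = (linPart n (dualIsom p)).symm (dualIsom p 0) := rfl
  rw [h, linPart_dualIsom, dualIsom_apply, zero_add, LinearIsometryEquiv.symm_apply_apply]

theorem dualIsom_mem (p : pointGroup Γ × dualLattice Γ) : dualIsom p ∈ dualCrystalGroup Γ := by
  refine ⟨?_, ?_⟩
  · rw [linPart_dualIsom]
    exact p.1.2
  · rw [transPart_dualIsom]
    exact p.2.2

theorem dualIsom_injective : Function.Injective (dualIsom (Γ := Γ)) := by
  intro p q h
  refine Prod.ext (Subtype.ext ?_) (Subtype.ext ?_)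
  · rw [← linPart_dualIsom, h, linPart_dualIsom]
  · rw [← transPart_dualIsom, h, transPart_dualIsom]

theorem exists_dualIsom_eq {g : Isom n} (hg : g ∈ dualCrystalGroup Γ) :
    ∃ p : pointGroup Γ × dualLattice Γ, dualIsom p = g := by
  refine ⟨(⟨linPart n g, hg.1⟩, ⟨transPart g, hg.2⟩), ?_⟩
  ext1 y
  rw [isom_apply' g]
  rfl

variable {R Ω : Set (Eucl n)}

theorem IsFundamentalDomain.eq_of_mem (hR : IsFundamentalDomain (dualCrystalGroup Γ) R)
    {p q : pointGroup Γ × dualLattice Γ} {y : Eucl n}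
    (hp : (dualIsom p)⁻¹ y ∈ R) (hq : (dualIsom q)⁻¹ y ∈ R) : p = q := by
  by_contra hne
  have h := hR.disjoint _ (dualIsom_mem p) _ (dualIsom_mem q) (fun h => hne (dualIsom_injective h))
  exact Set.disjoint_left.1 h ⟨_, hp, dualIsom_apply_inv_apply p y⟩
    ⟨_, hq, dualIsom_apply_inv_apply q y⟩

/-- The translates of R are disjoint nonempty open sets in a separable space. -/
theorem IsFundamentalDomain.countable_index (hR : IsFundamentalDomain (dualCrystalGroup Γ) R) :
    Countable (pointGroup Γ × dualLattice Γ) := by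
  have h : Pairwise fun p q : pointGroup Γ × dualLattice Γ =>
      Disjoint (dualIsom p '' R) (dualIsom q '' R) := fun p q hpq =>
    hR.disjoint _ (dualIsom_mem p) _ (dualIsom_mem q) (fun h => hpq (dualIsom_injective h))
  refine h.countable_of_isOpen_disjoint (fun p => ?_) (fun p => hR.connected.nonempty.image _)
  exact (dualIsom p).toHomeomorph.isOpenMap _ hR.isOpen

theorem IsFundamentalDomain.countable_pointGroup
    (hR : IsFundamentalDomain (dualCrystalGroup Γ) R) : Countable (pointGroup Γ) := by
  have := hR.countable_index
  exact Function.Injective.countable (f := fun M : pointGroup Γ => (M, (0 : dualLattice Γ)))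
    fun M N h => congrArg Prod.fst h

theorem IsFundamentalDomain.countable_dualLattice
    (hR : IsFundamentalDomain (dualCrystalGroup Γ) R) : Countable (dualLattice Γ) := by
  have := hR.countable_index
  exact Function.Injective.countable (f := fun w : dualLattice Γ => ((1 : pointGroup Γ), w))
    fun M N h => congrArg Prod.snd h

theorem exists_inv_mem_of_isFundamentalSet (hΩ : IsFundamentalSet (dualCrystalGroup Γ) Ω)
    (y : Eucl n) : ∃ p : pointGroup Γ × dualLattice Γ, (dualIsom p)⁻¹ y ∈ Ω := by
  obtain ⟨z, ⟨hz, g, hg, rfl⟩, -⟩ := hΩ y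
  obtain ⟨p, hp⟩ := exists_dualIsom_eq (inv_mem hg)
  refine ⟨p, ?_⟩
  rw [hp, inv_inv]
  exact hz

/-- The frontier of a convex set is null; this is where convexity of R enters. -/
theorem ae_eq_of_between (hRo : IsOpen R) (hRconv : Convex ℝ R)
    (hRΩ : R ⊆ Ω) (hΩR : Ω ⊆ closure R) : Ω =ᵐ[volume] R := by
  have h0 : volume (frontier R) = 0 := hRconv.addHaar_frontier volume
  refine Filter.EventuallyLE.antisymm ?_ (LE.le.eventuallyLE hRΩ)
  refine ae_le_set.2 (measure_mono_null ?_ h0)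
  intro x hx
  rw [frontier, hRo.interior_eq]
  exact ⟨hΩR hx.1, hx.2⟩

/-- Translates of Ω can overlap at points with nontrivial stabilizer, whereas translates of R
cannot. Outside countably many null sets the two kinds of cells agree. -/
theorem ae_unique_cell (hR : IsFundamentalDomain (dualCrystalGroup Γ) R)
    (hΩ : IsFundamentalSet (dualCrystalGroup Γ) Ω) (hae : Ω =ᵐ[volume] R) :
    ∀ᵐ y : Eucl n, ∃ p : pointGroup Γ × dualLattice Γ,
      (dualIsom p)⁻¹ y ∈ R ∧ (dualIsom p)⁻¹ y ∈ Ω ∧ ∀ q, (dualIsom q)⁻¹ y ∈ Ω → q = p := by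
  have := hR.countable_index
  have h : ∀ p : pointGroup Γ × dualLattice Γ, ∀ᵐ y : Eucl n,
      ((dualIsom p)⁻¹ y ∈ Ω) = ((dualIsom p)⁻¹ y ∈ R) := fun p =>
    (measurePreserving_isom (dualIsom p)⁻¹).quasiMeasurePreserving.ae hae
  filter_upwards [ae_all_iff.2 h] with y hy
  obtain ⟨p, hp⟩ := exists_inv_mem_of_isFundamentalSet hΩ y
  have hpR : (dualIsom p)⁻¹ y ∈ R := by rwa [← hy p]
  exact ⟨p, hpR, hp, fun q hq => hR.eq_of_mem (by rwa [← hy q]) hpR⟩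

/-! ### Periodic sets -/

/-- The `𝓛*`-periodic set `M E + 𝓛*`. -/
def periodicSet (M : pointGroup Γ) (E : Set (Eucl n)) : Set (Eucl n) :=
  {y | ∃ w : dualLattice Γ, (dualIsom (M, w))⁻¹ y ∈ E}

theorem measurableSet_periodicSet [Countable (dualLattice Γ)] (M : pointGroup Γ)
    {E : Set (Eucl n)} (hE : MeasurableSet E) : MeasurableSet (periodicSet M E) := by
  rw [periodicSet, Set.ofPred_exists]
  exact MeasurableSet.iUnion fun w => (dualIsom (M, w))⁻¹.continuous.measurable hE

/-- Since E ⊆ R, the pieces of ME + 𝓛* stay in the cells with linear part M. Cutting down to this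
set therefore selects one slice and, within it, the part over E. -/
theorem mem_periodicSet_iff (hR : IsFundamentalDomain (dualCrystalGroup Γ) R)
    {E : Set (Eucl n)} (hE : E ⊆ R) {M : pointGroup Γ} {p : pointGroup Γ × dualLattice Γ}
    {y : Eucl n} (hy : (dualIsom p)⁻¹ y ∈ R) :
    y ∈ periodicSet M E ↔ p.1 = M ∧ (dualIsom p)⁻¹ y ∈ E := by
  constructor
  · rintro ⟨w, hw⟩
    obtain rfl := hR.eq_of_mem hy (hE hw)
    exact ⟨rfl, hw⟩
  · rintro ⟨rfl, h⟩
    exact ⟨p.2, h⟩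

/-- The family of all lattice characters at a point. -/
def latticeChars (Γ : Subgroup (Isom n)) (y : Eucl n) (x : lattice Γ) : ℂ := chi y x

theorem latticeChars_eq_iff {y y' : Eucl n} :
    latticeChars Γ y = latticeChars Γ y' ↔ y - y' ∈ dualLattice Γ := by
  constructor
  · exact fun h => sub_mem_dualLattice_of_chi_eq fun x hx => congrFun h ⟨x, hx⟩
  · intro h
    funext x
    have h1 : chi y x = chi (y - y') x * chi y' x := by rw [← chi_add_left, sub_add_cancel]
    exact h1.trans (by rw [chi_eq_one h x.2, one_mul]; rfl)

/-- The characters of 𝓛 distinguish points exactly modulo 𝓛*, and no two points of R differ by an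
element of 𝓛*. So the character map is injective on ME, the image of ME is measurable by the
Lusin–Souslin theorem, and its preimage is ME + 𝓛*. -/
theorem periodicSet_eq_preimage (hR : IsFundamentalDomain (dualCrystalGroup Γ) R)
    [Countable (lattice Γ)] {E : Set (Eucl n)} (hE : E ⊆ R) (hEm : MeasurableSet E)
    (M : pointGroup Γ) :
    ∃ A : Set (lattice Γ → ℂ), MeasurableSet A ∧ periodicSet M E = latticeChars Γ ⁻¹' A := by
  have hm : Measurable (latticeChars Γ) :=
    measurable_pi_lambda _ fun x => (continuous_chi_left _).measurable
  refine ⟨(fun e => latticeChars Γ (M.1 e)) '' E,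
    hEm.image_of_measurable_injOn (hm.comp M.1.continuous.measurable) ?_, ?_⟩
  · intro e he e' he' h
    have h1 := latticeChars_eq_iff.1 h
    rw [← map_sub] at h1
    have h2 := map_mem_dualLattice (inv_mem M.2) h1
    rw [inv_apply_apply] at h2
    -- With w = e - e', both e - 0 and e - w = e' lie in R, so e lies in the cells of (1, 0) and (1,
    -- w); disjointness forces w = 0.
    have h3 : (dualIsom ((1 : pointGroup Γ), (0 : dualLattice Γ)))⁻¹ e ∈ R := by
      rw [dualIsom_inv_apply]
      simpa using hE he
    have h4 : (dualIsom ((1 : pointGroup Γ), (⟨_, h2⟩ : dualLattice Γ)))⁻¹ e ∈ R := by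
      rw [dualIsom_inv_apply]
      simpa using hE he'
    have h5 := congrArg (fun p => (p.2 : Eucl n)) (hR.eq_of_mem h3 h4)
    exact (sub_eq_zero.1 h5.symm)
  · ext y
    constructor
    · rintro ⟨w, hw⟩
      refine ⟨_, hw, ?_⟩
      refine latticeChars_eq_iff.2 ?_
      rw [dualIsom_inv_apply, map_sub, apply_inv_apply, sub_sub_cancel_left]
      exact neg_mem (map_mem_dualLattice M.2 w.2)
    · rintro ⟨e, he, h⟩
      have h1 := neg_mem (latticeChars_eq_iff.1 h)
      have h2 := map_mem_dualLattice (inv_mem M.2) h1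
      refine ⟨⟨_, h2⟩, ?_⟩
      rw [dualIsom_inv_apply]
      simpa [inv_apply_apply] using he

/-- An integrable function orthogonal to all lattice characters has integral zero over every
periodic set. -/
theorem setIntegral_periodicSet_eq_zero (hR : IsFundamentalDomain (dualCrystalGroup Γ) R)
    [Countable (lattice Γ)] {E : Set (Eucl n)} (hE : E ⊆ R) (hEm : MeasurableSet E)
    (M : pointGroup Γ) {Q : Eucl n → ℂ} (hQ : Integrable Q)
    (h0 : ∀ x ∈ lattice Γ, ∫ y, Q y * chi y x = 0) : ∫ y in periodicSet M E, Q y = 0 := by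
  obtain ⟨A, hA, h⟩ := periodicSet_eq_preimage hR hE hEm M
  rw [h]
  exact isCircleGroup_chi.setIntegral_eq_zero hQ (fun x => h0 x x.2) hA

/-! ### The shift representation on the Fourier side -/

theorem memLp_chi (x : Eucl n) {μ : Measure (Eucl n)} : MemLp (fun y => chi y x) ∞ μ :=
  memLp_top_of_norm_le (continuous_chi_left x).aestronglyMeasurable (fun y => (norm_chi y x).le)

/-- Composition with the inverse of a linear isometry, on `L²(ℝⁿ)`. -/
def rotate (L : Eucl n ≃ₗᵢ[ℝ] Eucl n) : L2 n →ₗᵢ[ℂ] L2 n :=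
  Lp.compMeasurePreservingₗᵢ ℂ (fun y => L⁻¹ y) L⁻¹.measurePreserving

theorem coeFn_rotate (L : Eucl n ≃ₗᵢ[ℝ] Eucl n) (f : L2 n) :
    rotate L f =ᵐ[volume] fun y => f (L⁻¹ y) :=
  Lp.coeFn_compMeasurePreserving f L⁻¹.measurePreserving

theorem coeFn_shift (g : Isom n) (f : L2 n) : shift g f =ᵐ[volume] fun y => f (g⁻¹ y) :=
  Lp.coeFn_compMeasurePreserving f (measurePreserving_isom g⁻¹)

/-- The operator `π(g)` transported by the Plancherel transform: for `g = [x, L]` it maps `h` to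
`y ↦ χ_{L⁻¹ y}(x) h (L⁻¹ y)`. -/
def dualShift (g : Isom n) : L2 n →ₗᵢ[ℂ] L2 n :=
  (mulIsom (fun y => chi y (g 0)) (memLp_chi _) (fun y => norm_chi y _)).comp
    (rotate (linPart n g))

theorem coeFn_dualShift (g : Isom n) (f : L2 n) :
    dualShift g f =ᵐ[volume] fun y => chi y (g 0) * f ((linPart n g)⁻¹ y) := by
  filter_upwards [coeFn_mulIsom (fun y => chi y (g 0)) (memLp_chi _) (fun y => norm_chi y _)
    (rotate (linPart n g) f), coeFn_rotate (linPart n g) f] with y h1 h2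
  exact h1.trans (by rw [h2, smul_eq_mul])

open scoped FourierTransform SchwartzMap

/-- Composition of a Schwartz function with the inverse of an isometry. -/
def schwartzShift (g : Isom n) : 𝓢(Eucl n, ℂ) →L[ℂ] 𝓢(Eucl n, ℂ) :=
  SchwartzMap.compCLMOfAntilipschitz (K := 1) (g := fun y => g⁻¹ y) ℂ
    (by
      have h : (fun y => g⁻¹ y) = fun y => (g⁻¹).linearIsometryEquiv y + g⁻¹ 0 :=
        funext fun y => isom_apply g⁻¹ y
      rw [h]
      exact (ContinuousLinearMap.hasTemperateGrowth
        (g⁻¹).linearIsometryEquiv.toContinuousLinearEquiv.toContinuousLinearMap).add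
          (Function.HasTemperateGrowth.const _))
    (g⁻¹).isometry.antilipschitz

theorem schwartzShift_apply (g : Isom n) (f : 𝓢(Eucl n, ℂ)) (y : Eucl n) :
    schwartzShift g f y = f (g⁻¹ y) := rfl

/-- Substitute u ↦ g u in the integral and split the inner product of g u = L u + g 0 with y; here g
0 = L x when g = [x, L]. -/
theorem fourierInv_schwartzShift (g : Isom n) (f : 𝓢(Eucl n, ℂ)) (y : Eucl n) :
    (𝓕⁻ (schwartzShift g f)) y = chi y (g 0) * (𝓕⁻ f) ((linPart n g)⁻¹ y) := by
  rw [SchwartzMap.fourierInv_coe, SchwartzMap.fourierInv_coe, Real.fourierInv_eq',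
    Real.fourierInv_eq', ← integral_const_mul,
    ← (measurePreserving_isom g).integral_comp g.toHomeomorph.measurableEmbedding]
  refine integral_congr_ae (Filter.Eventually.of_forall fun u => ?_)
  have h1 : g⁻¹ (g u) = u := g.symm_apply_apply u
  have h2 : ⟪g u, y⟫_ℝ = ⟪y, g 0⟫_ℝ + ⟪u, (linPart n g)⁻¹ y⟫_ℝ := by
    rw [isom_apply, inner_add_left, add_comm, real_inner_comm]
    congr 1
    rw [← (linPart n g).inner_map_map u, apply_inv_apply]
    rfl
  simp only [schwartzShift_apply, smul_eq_mul]
  rw [h1, h2, ← mul_assoc, chi, ← Complex.exp_add]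
  congr 2
  push_cast
  ring

theorem plancherel_toLp (f : 𝓢(Eucl n, ℂ)) : plancherel n (f.toLp 2) = (𝓕⁻ f).toLp 2 :=
  SchwartzMap.toLp_fourierInv_eq f

/-- The Plancherel transform intertwines `π(g)` with its dual version. -/
theorem plancherel_shift (g : Isom n) (f : L2 n) :
    plancherel n (shift g f) = dualShift g (plancherel n f) := by
  -- Both sides are continuous in f, so it suffices to compare them on Schwartz functions, where the
  -- transform is an honest integral.
  have hd : DenseRange (SchwartzMap.toLpCLM ℂ ℂ 2 (volume : Measure (Eucl n))) :=
    SchwartzMap.denseRange_toLpCLM (F := ℂ) (E := Eucl n) ENNReal.ofNat_ne_top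
  refine congrFun (hd.equalizer (g := fun f => plancherel n (shift g f))
    (h := fun f => dualShift g (plancherel n f))
    ((plancherel n).continuous.comp (shift g).continuous)
    ((dualShift g).continuous.comp (plancherel n).continuous) (funext fun f => ?_)) f
  change plancherel n (shift g (f.toLp 2)) = dualShift g (plancherel n (f.toLp 2))
  have h1 : shift g (f.toLp 2) = (schwartzShift g f).toLp 2 := by
    refine Lp.ext ?_
    refine (coeFn_shift g _).trans ?_
    refine Filter.EventuallyEq.trans ?_ (SchwartzMap.coeFn_toLp _ 2 volume).symm
    exact (measurePreserving_isom g⁻¹).quasiMeasurePreserving.ae_eq (f.coeFn_toLp 2 volume)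
  rw [h1, plancherel_toLp, plancherel_toLp]
  refine Lp.ext ?_
  refine (SchwartzMap.coeFn_toLp _ 2 volume).trans ?_
  refine Filter.EventuallyEq.trans ?_ (coeFn_dualShift g _).symm
  have h2 := (linPart n g)⁻¹.measurePreserving.quasiMeasurePreserving.ae_eq
    ((𝓕⁻ f).coeFn_toLp 2 volume)
  filter_upwards [h2] with y hy
  rw [fourierInv_schwartzShift]
  exact congrArg _ hy.symm

/-! ### Slices of the fiber `l²(Π) ⊗ l²(𝓛*)` -/

section Fiber

open Classical in
/-- The basis vector `δ_N ⊗ δ_w`. -/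
def delta (p : pointGroup Γ × dualLattice Γ) : Fiber Γ := lp.single 2 p (1 : ℂ)

@[simp] theorem delta_self (p : pointGroup Γ × dualLattice Γ) : delta p p = 1 := by
  simp [delta]

theorem delta_ne {p q : pointGroup Γ × dualLattice Γ} (h : q ≠ p) : delta p q = 0 := by
  simp [delta, lp.single_apply, h]

theorem norm_delta (p : pointGroup Γ × dualLattice Γ) : ‖delta p‖ = 1 := by
  classical
  rw [delta, lp.norm_single (by norm_num)]
  simp

theorem inner_delta_left (p : pointGroup Γ × dualLattice Γ) (v : Fiber Γ) :
    ⟪delta p, v⟫_ℂ = v p := by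
  classical
  rw [delta, lp.inner_single_left]
  simp

theorem memℓp_slice (M : pointGroup Γ) (v : Fiber Γ) :
    Memℓp (fun w : dualLattice Γ => v (M, w)) 2 := by
  have h2 : (0 : ℝ) < (2 : ℝ≥0∞).toReal := by norm_num
  refine (memℓp_gen_iff h2).2 ?_
  exact ((memℓp_gen_iff h2).1 v.2).comp_injective (Prod.mk_right_injective M)

/-- The slice `v ↦ v(M, ·)`. -/
def slice (M : pointGroup Γ) : Fiber Γ →L[ℂ] ellDual Γ :=
  LinearMap.mkContinuous
    { toFun := fun v => (⟨fun w => v (M, w), memℓp_slice M v⟩ : ellDual Γ)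
      map_add' := fun _ _ => rfl
      map_smul' := fun _ _ => rfl } 1 fun v => by
    rw [one_mul]
    have h2 : (0 : ℝ) < (2 : ℝ≥0∞).toReal := by norm_num
    refine lp.norm_le_of_tsum_le h2 (norm_nonneg _) ?_
    rw [lp.norm_rpow_eq_tsum h2 v]
    exact tsum_comp_le_tsum_of_inj ((memℓp_gen_iff h2).1 v.2) (fun _ => by positivity)
      (Prod.mk_right_injective M)

@[simp] theorem slice_apply (M : pointGroup Γ) (v : Fiber Γ) (w : dualLattice Γ) :
    slice M v w = v (M, w) := rfl

theorem slice_tensor (M : pointGroup Γ) (ζ : ellPoint Γ) (β : ellDual Γ) :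
    slice M (tensor ζ β) = ζ M • β := by
  ext w
  rfl

/-- The inner product of the fiber as a sum over slices. -/
theorem hasSum_inner_slice (u v : Fiber Γ) :
    HasSum (fun M => ⟪slice M u, slice M v⟫_ℂ) ⟪u, v⟫_ℂ :=
  (lp.hasSum_inner u v).prod_fiberwise fun M => lp.hasSum_inner (slice M u) (slice M v)

theorem inner_eq_zero_of_slice {u v : Fiber Γ} (h : ∀ M, ⟪slice M u, slice M v⟫_ℂ = 0) :
    ⟪u, v⟫_ℂ = 0 := by
  have h1 := hasSum_inner_slice u v
  simp_rw [h] at h1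
  exact h1.unique hasSum_zero

theorem adjoint_slice_apply (M : pointGroup Γ) (β : ellDual Γ)
    (p : pointGroup Γ × dualLattice Γ) [Decidable (p.1 = M)] :
    (slice M).adjoint β p = if p.1 = M then β p.2 else 0 := by
  classical
  rw [← inner_delta_left, ContinuousLinearMap.adjoint_inner_right]
  obtain ⟨N, w⟩ := p
  by_cases h : N = M
  · subst h
    have h1 : slice N (delta (N, w)) = lp.single 2 w (1 : ℂ) := by
      ext w'
      by_cases hw : w' = w
      · subst hw
        simp
      · rw [slice_apply, delta_ne (fun h => hw (congrArg Prod.snd h)), lp.single_apply_ne _ _ _ hw]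
    rw [h1, lp.inner_single_left]
    simp
  · have h1 : slice M (delta (N, w)) = 0 := by
      ext w'
      rw [slice_apply, delta_ne (fun h' => h (congrArg Prod.fst h').symm)]
      rfl
    rw [h1, inner_zero_left]
    simp [h]

theorem adjoint_slice_eq_tensor (M : pointGroup Γ) (β : ellDual Γ) :
    ∃ ζ : ellPoint Γ, (slice M).adjoint β = tensor ζ β := by
  classical
  refine ⟨lp.single 2 M (1 : ℂ), ?_⟩
  ext p
  rw [adjoint_slice_apply]
  change _ = (lp.single 2 M (1 : ℂ) : ellPoint Γ) p.1 * β p.2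
  by_cases h : p.1 = M
  · rw [h]
    simp
  · rw [lp.single_apply_ne _ _ _ h]
    simp [h]

theorem slice_adjoint_slice (M : pointGroup Γ) (β : ellDual Γ) :
    slice M ((slice M).adjoint β) = β := by
  classical
  ext w
  rw [slice_apply, adjoint_slice_apply]
  simp

/-- Pairing u with δ_M ⊗ β reads off the slice M of u, and conversely the fiber inner product is the
sum over slices. -/
theorem mem_orthogonal_tensorSubspace {F : Submodule ℂ (ellDual Γ)} {u : Fiber Γ} :
    u ∈ (tensorSubspace F)ᗮ ↔ ∀ M, slice M u ∈ Fᗮ := by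
  rw [tensorSubspace, Submodule.orthogonal_closure]
  constructor
  · intro h M β hβ
    obtain ⟨ζ, hζ⟩ := adjoint_slice_eq_tensor M β
    have h1 := h _ (Submodule.subset_span ⟨ζ, β, hβ, hζ⟩)
    rwa [ContinuousLinearMap.adjoint_inner_left] at h1
  · intro h
    have h1 : Submodule.span ℂ {v | ∃ ζ : ellPoint Γ, ∃ β ∈ F, v = tensor ζ β} ≤
        (Submodule.span ℂ {u})ᗮ := by
      rw [Submodule.span_le]
      rintro _ ⟨ζ, β, hβ, rfl⟩
      rw [SetLike.mem_coe, Submodule.mem_orthogonal_singleton_iff_inner_left]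
      refine inner_eq_zero_of_slice fun M => ?_
      rw [slice_tensor, inner_smul_left, h M β hβ, mul_zero]
    intro v hv
    exact Submodule.mem_orthogonal_singleton_iff_inner_left.1 (h1 hv)

theorem isClosed_tensorSubspace (F : Submodule ℂ (ellDual Γ)) :
    IsClosed (tensorSubspace F : Set (Fiber Γ)) := Submodule.isClosed_topologicalClosure _

/-- This slicewise test is what makes the tensor form of the fibers usable. The converse uses the
double orthogonal complement: a vector orthogonal to `tensorSubspace F` has all its slices in Fᗮ,
hence is orthogonal to v slice by slice. -/
theorem mem_tensorSubspace {F : Submodule ℂ (ellDual Γ)} (hF : IsClosed (F : Set (ellDual Γ)))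
    {v : Fiber Γ} : v ∈ tensorSubspace F ↔ ∀ M, slice M v ∈ F := by
  constructor
  · intro h M
    have h1 : tensorSubspace F ≤ F.comap (slice M).toLinearMap := by
      refine Submodule.topologicalClosure_minimal _ ?_ (hF.preimage (slice M).continuous)
      rw [Submodule.span_le]
      rintro _ ⟨ζ, β, hβ, rfl⟩
      change slice M (tensor ζ β) ∈ F
      rw [slice_tensor]
      exact F.smul_mem _ hβ
    exact h1 h
  · intro h
    have := (isClosed_tensorSubspace F).completeSpace_coe
    rw [← (tensorSubspace F).orthogonal_orthogonal]
    intro u hu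
    refine inner_eq_zero_of_slice fun M => ?_
    rw [← inner_conj_symm, mem_orthogonal_tensorSubspace.1 hu M _ (h M), map_zero]

/-- The partial isometry `v ↦ δ_M ⊗ v(N, ·)`. -/
def moveSlice (M N : pointGroup Γ) : Fiber Γ →L[ℂ] Fiber Γ := (slice M).adjoint ∘L slice N

theorem slice_moveSlice (M N : pointGroup Γ) (v : Fiber Γ) :
    slice M (moveSlice M N v) = slice N v := by
  rw [moveSlice, ContinuousLinearMap.comp_apply, slice_adjoint_slice]

theorem inner_moveSlice (M N : pointGroup Γ) (u v : Fiber Γ) :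
    ⟪u, moveSlice M N v⟫_ℂ = ⟪slice M u, slice N v⟫_ℂ := by
  rw [moveSlice, ContinuousLinearMap.comp_apply, ContinuousLinearMap.adjoint_inner_right]

theorem moveSlice_apply (M N : pointGroup Γ) (v : Fiber Γ) (p : pointGroup Γ × dualLattice Γ)
    [Decidable (p.1 = M)] : moveSlice M N v p = if p.1 = M then v (N, p.2) else 0 := by
  rw [moveSlice, ContinuousLinearMap.comp_apply, adjoint_slice_apply, slice_apply]

theorem moveSlice_delta_self (M N : pointGroup Γ) (w : dualLattice Γ) :
    moveSlice M N (delta (N, w)) = delta (M, w) := by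
  classical
  refine lp.ext (funext fun p => ?_)
  rw [moveSlice_apply]
  obtain ⟨K, z⟩ := p
  by_cases hK : K = M
  · subst hK
    by_cases hz : z = w
    · subst hz
      rw [if_pos rfl, delta_self, delta_self]
    · rw [if_pos rfl, delta_ne (fun h => hz (congrArg Prod.snd h)),
        delta_ne (fun h => hz (congrArg Prod.snd h))]
  · rw [if_neg hK, delta_ne (fun h => hK (congrArg Prod.fst h))]

theorem moveSlice_delta_ne (M : pointGroup Γ) {N N' : pointGroup Γ} (h : N' ≠ N)
    (w : dualLattice Γ) : moveSlice M N (delta (N', w)) = 0 := by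
  classical
  refine lp.ext (funext fun p => ?_)
  rw [moveSlice_apply, delta_ne (fun h' => h (congrArg Prod.fst h').symm), ite_self]
  rfl

end Fiber

/-! ### Coordinates of `L²(Ω; l²(Π) ⊗ l²(𝓛*))` -/

/-- `L²(Ω)`. -/
abbrev ScalarL2 (Ω : Set (Eucl n)) : Type := Lp ℂ 2 ((volume : Measure (Eucl n)).restrict Ω)

/-- `a ↦ a δ_N ⊗ δ_w`. -/
def coordEmbed (Ω : Set (Eucl n)) (p : pointGroup Γ × dualLattice Γ) :
    ScalarL2 Ω →ₗᵢ[ℂ] L2Fiber Γ Ω := smulVec (delta p) (norm_delta p)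

theorem coeFn_coordEmbed (p : pointGroup Γ × dualLattice Γ) (a : ScalarL2 Ω) :
    coordEmbed Ω p a =ᵐ[volume.restrict Ω] fun ω => a ω • delta p := coeFn_smulVec _ _ _

/-- The coordinate functions, as elements of `L²(Ω)`. -/
def coordL (Ω : Set (Eucl n)) (p : pointGroup Γ × dualLattice Γ) : L2Fiber Γ Ω →L[ℂ] ScalarL2 Ω :=
  (innerSL ℂ (delta p)).compLpL 2 _

theorem coeFn_coordL (p : pointGroup Γ × dualLattice Γ) (f : L2Fiber Γ Ω) :
    coordL Ω p f =ᵐ[volume.restrict Ω] fun ω => f ω p := by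
  filter_upwards [(innerSL ℂ (delta p)).coeFn_compLpL (p := 2) f] with ω h
  exact h.trans (inner_delta_left p (f ω))

theorem coordL_coordEmbed_self (p : pointGroup Γ × dualLattice Γ) (a : ScalarL2 Ω) :
    coordL Ω p (coordEmbed Ω p a) = a := by
  refine Lp.ext ?_
  filter_upwards [coeFn_coordL p (coordEmbed Ω p a), coeFn_coordEmbed p a] with ω h1 h2
  rw [h1, h2]
  simp

theorem coordL_coordEmbed_ne {p q : pointGroup Γ × dualLattice Γ} (h : p ≠ q) (a : ScalarL2 Ω) :
    coordL Ω p (coordEmbed Ω q a) = 0 := by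
  refine Lp.ext ?_
  filter_upwards [coeFn_coordL p (coordEmbed Ω q a), coeFn_coordEmbed q a,
    Lp.coeFn_zero ℂ 2 (volume.restrict Ω)] with ω h1 h2 h3
  rw [h1, h2, h3]
  simp [delta_ne h]

theorem inner_coordEmbed (p : pointGroup Γ × dualLattice Γ) (a : ScalarL2 Ω) (f : L2Fiber Γ Ω) :
    ⟪coordEmbed Ω p a, f⟫_ℂ = ⟪a, coordL Ω p f⟫_ℂ := by
  rw [L2.inner_def, L2.inner_def]
  refine integral_congr_ae ?_
  filter_upwards [coeFn_coordL p f, coeFn_coordEmbed p a] with ω h1 h2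
  rw [h1, h2, inner_smul_left, inner_delta_left, RCLike.inner_apply, mul_comm]

/-- A function orthogonal to all embedded coordinates has every coordinate zero almost everywhere;
countability of the index set allows one common null set. -/
theorem isHilbertSum_coordEmbed [Countable (pointGroup Γ × dualLattice Γ)] :
    IsHilbertSum ℂ (fun _ : pointGroup Γ × dualLattice Γ => ScalarL2 Ω) (coordEmbed Ω) := by
  refine IsHilbertSum.mk (fun p q hpq a b => ?_) ?_
  · rw [inner_coordEmbed, coordL_coordEmbed_ne hpq, inner_zero_right]
  · rw [top_le_iff, Submodule.topologicalClosure_eq_top_iff, Submodule.eq_bot_iff]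
    intro f hf
    have h : ∀ p : pointGroup Γ × dualLattice Γ, coordL Ω p f = 0 := by
      intro p
      have h1 := hf (coordEmbed Ω p (coordL Ω p f))
        (Submodule.mem_iSup_of_mem p ⟨_, rfl⟩)
      rwa [inner_coordEmbed, inner_self_eq_zero] at h1
    refine Lp.ext ?_
    have h2 : ∀ᵐ ω ∂(volume.restrict Ω), ∀ p : pointGroup Γ × dualLattice Γ, f ω p = 0 := by
      rw [ae_all_iff]
      intro p
      filter_upwards [coeFn_coordL p f, Lp.coeFn_zero ℂ 2 (volume.restrict Ω)] with ω h3 h4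
      rw [← h3, h p, h4]
      rfl
    filter_upwards [h2, Lp.coeFn_zero (Fiber Γ) 2 (volume.restrict Ω)] with ω h3 h4
    rw [h4]
    exact lp.ext (funext h3)

theorem isHilbertSum_coordEmbed_apply [Countable (pointGroup Γ × dualLattice Γ)]
    (f : L2Fiber Γ Ω) (p : pointGroup Γ × dualLattice Γ) :
    (isHilbertSum_coordEmbed (Γ := Γ) (Ω := Ω)).linearIsometryEquiv f p = coordL Ω p f := by
  have h := ((isHilbertSum_coordEmbed (Γ := Γ) (Ω := Ω)).hasSum_linearIsometryEquiv_symm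
    ((isHilbertSum_coordEmbed (Γ := Γ) (Ω := Ω)).linearIsometryEquiv f)).mapL (coordL Ω p)
  rw [LinearIsometryEquiv.symm_apply_apply] at h
  refine HasSum.unique ?_ h
  have h1 := hasSum_single (f := fun q => coordL Ω p (coordEmbed Ω q
    ((isHilbertSum_coordEmbed (Γ := Γ) (Ω := Ω)).linearIsometryEquiv f q))) p
    (fun q hq => coordL_coordEmbed_ne hq.symm _)
  rwa [coordL_coordEmbed_self] at h1

/-- The operator `f ↦ φ · (δ_M ⊗ f(·)(N, ·))`. -/
def sliceOp (Ω : Set (Eucl n)) (φ : Eucl n → ℂ) (hφ : MemLp φ ∞ (volume.restrict Ω))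
    (M N : pointGroup Γ) : L2Fiber Γ Ω →L[ℂ] L2Fiber Γ Ω :=
  mulOp φ hφ ∘L (moveSlice M N).compLpL 2 _

theorem coeFn_sliceOp (φ : Eucl n → ℂ) (hφ : MemLp φ ∞ (volume.restrict Ω))
    (M N : pointGroup Γ) (f : L2Fiber Γ Ω) :
    sliceOp Ω φ hφ M N f =ᵐ[volume.restrict Ω] fun ω => φ ω • moveSlice M N (f ω) := by
  filter_upwards [coeFn_mulOp φ hφ ((moveSlice M N).compLpL 2 _ f),
    (moveSlice M N).coeFn_compLpL (p := 2) f] with ω h1 h2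
  exact h1.trans (by rw [h2])

theorem sliceOp_coordEmbed_self (φ : Eucl n → ℂ) (hφ : MemLp φ ∞ (volume.restrict Ω))
    (M N : pointGroup Γ) (w : dualLattice Γ) (a : ScalarL2 Ω) :
    sliceOp Ω φ hφ M N (coordEmbed Ω (N, w) a) = coordEmbed Ω (M, w) (mulOp φ hφ a) := by
  refine Lp.ext ?_
  filter_upwards [coeFn_sliceOp φ hφ M N (coordEmbed Ω (N, w) a), coeFn_coordEmbed (N, w) a,
    coeFn_coordEmbed (M, w) (mulOp φ hφ a), coeFn_mulOp φ hφ a] with ω h1 h2 h3 h4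
  rw [h1, h2, h3, h4, map_smul, moveSlice_delta_self, smul_assoc]

theorem sliceOp_coordEmbed_ne (φ : Eucl n → ℂ) (hφ : MemLp φ ∞ (volume.restrict Ω))
    (M : pointGroup Γ) {N N' : pointGroup Γ} (hN : N' ≠ N) (w : dualLattice Γ) (a : ScalarL2 Ω) :
    sliceOp Ω φ hφ M N (coordEmbed Ω (N', w) a) = 0 := by
  refine Lp.ext ?_
  filter_upwards [coeFn_sliceOp φ hφ M N (coordEmbed Ω (N', w) a), coeFn_coordEmbed (N', w) a,
    Lp.coeFn_zero (Fiber Γ) 2 (volume.restrict Ω)] with ω h1 h2 h3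
  rw [h1, h2, h3, map_smul, moveSlice_delta_ne M hN]
  simp

/-! ### The cells of the dual crystal group and the intertwiner -/

theorem continuous_chi_inv (N : Eucl n ≃ₗᵢ[ℝ] Eucl n) (x : Eucl n) :
    Continuous (fun y => chi (N⁻¹ y) x) := (continuous_chi_left x).comp N⁻¹.continuous

theorem memLp_chi_inv (N : Eucl n ≃ₗᵢ[ℝ] Eucl n) (x : Eucl n) {μ : Measure (Eucl n)} :
    MemLp (fun y => chi (N⁻¹ y) x) ∞ μ :=
  memLp_top_of_norm_le (continuous_chi_inv N x).aestronglyMeasurable (fun _ => (norm_chi _ x).le)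

/-- The isometry `a ↦ X(N) p'_{a, [N w, N]}` from `L²(Ω)` to `L²(ℝⁿ)`. -/
def embedCell (γ : pointGroup Γ → Γ) (hm : NullMeasurableSet Ω)
    (p : pointGroup Γ × dualLattice Γ) : ScalarL2 Ω →ₗᵢ[ℂ] L2 n :=
  (mulIsom (fun y => chi (p.1.1⁻¹ y) (transPart (γ p.1).1)) (memLp_chi_inv _ _)
    (fun _ => norm_chi _ _)).comp ((shift (dualIsom p)).comp (extendZero Ω hm))

theorem coeFn_embedCell (γ : pointGroup Γ → Γ) (hm : NullMeasurableSet Ω)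
    (p : pointGroup Γ × dualLattice Γ) (a : ScalarL2 Ω) :
    embedCell γ hm p a =ᵐ[volume] fun y =>
      chi (p.1.1⁻¹ y) (transPart (γ p.1).1) * Ω.indicator a ((dualIsom p)⁻¹ y) := by
  filter_upwards [coeFn_mulIsom (fun y => chi (p.1.1⁻¹ y) (transPart (γ p.1).1))
    (memLp_chi_inv _ _) (fun _ => norm_chi _ _) (shift (dualIsom p) (extendZero Ω hm a)),
    coeFn_shift (dualIsom p) (extendZero Ω hm a),
    (measurePreserving_isom (dualIsom p)⁻¹).quasiMeasurePreserving.ae_eq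
      (coeFn_extendZero Ω hm a)] with y h1 h2 h3
  refine h1.trans ?_
  rw [h2, smul_eq_mul]
  exact congrArg _ h3

/-- The range of `embedCell` consists of all functions supported in the cell. -/
theorem exists_embedCell_eq (γ : pointGroup Γ → Γ) (hm : NullMeasurableSet Ω)
    (p : pointGroup Γ × dualLattice Γ) (g : L2 n) :
    ∃ a, embedCell γ hm p a =ᵐ[volume] ((fun y => (dualIsom p)⁻¹ y) ⁻¹' Ω).indicator g := by
  -- The preimage is built backwards: the conjugate character cancels the factor X(N), then the
  -- inverse isometry moves the cell back to Ω.
  let u : L2 n := mulOp (fun y => (starRingEnd ℂ) (chi (p.1.1⁻¹ y) (transPart (γ p.1).1)))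
    (memLp_chi_inv _ _).star g
  let v : L2 n := shift (dualIsom p)⁻¹ u
  have hv : MemLp v 2 (volume.restrict Ω) := (Lp.memLp v).restrict Ω
  refine ⟨hv.toLp, ?_⟩
  have h1 : v =ᵐ[volume] fun y => u (dualIsom p y) := by
    have h := coeFn_shift (dualIsom p)⁻¹ u
    rwa [inv_inv] at h
  have h2 := (measurePreserving_isom (dualIsom p)⁻¹).quasiMeasurePreserving.ae_eq h1
  have h3 := (measurePreserving_isom (dualIsom p)⁻¹).quasiMeasurePreserving.ae_eq
    (indicator_ae_eq_of_restrict hm hv.coeFn_toLp)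
  filter_upwards [coeFn_embedCell γ hm p hv.toLp, h2, h3,
    coeFn_mulOp (fun y => (starRingEnd ℂ) (chi (p.1.1⁻¹ y) (transPart (γ p.1).1)))
      (memLp_chi_inv _ _).star g] with y k1 k2 k3 k4
  rw [k1]
  simp only [Function.comp_apply] at k2 k3
  rw [k3]
  by_cases hy : (dualIsom p)⁻¹ y ∈ Ω
  · rw [Set.indicator_of_mem hy, Set.indicator_of_mem (by exact hy), k2, dualIsom_apply_inv_apply]
    refine (congrArg _ k4).trans ?_
    rw [smul_eq_mul, ← mul_assoc, Complex.mul_conj, Complex.normSq_eq_norm_sq, norm_chi]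
    simp
  · rw [Set.indicator_of_notMem hy, Set.indicator_of_notMem (by exact hy), mul_zero]

/-- Functions supported in different cells are orthogonal because almost every point has a unique
cell. They are total because the cells cover ℝⁿ and every square integrable function supported in a
cell is attained. -/
theorem isHilbertSum_embedCell (γ : pointGroup Γ → Γ) (hm : NullMeasurableSet Ω)
    (hR : IsFundamentalDomain (dualCrystalGroup Γ) R)
    (hΩ : IsFundamentalSet (dualCrystalGroup Γ) Ω) (hae : Ω =ᵐ[volume] R) :
    IsHilbertSum ℂ (fun _ : pointGroup Γ × dualLattice Γ => ScalarL2 Ω) (embedCell γ hm) := by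
  have := hR.countable_index
  refine IsHilbertSum.mk (fun p q hpq a b => ?_) ?_
  · rw [L2.inner_def]
    refine integral_eq_zero_of_ae ?_
    filter_upwards [coeFn_embedCell γ hm p a, coeFn_embedCell γ hm q b,
      ae_unique_cell hR hΩ hae] with y h1 h2 h3
    obtain ⟨r, -, -, hr⟩ := h3
    rw [h1, h2]
    by_cases hp : (dualIsom p)⁻¹ y ∈ Ω
    · have hq : (dualIsom q)⁻¹ y ∉ Ω := fun hq => hpq ((hr p hp).trans (hr q hq).symm)
      rw [Set.indicator_of_notMem hq]
      simp
    · rw [Set.indicator_of_notMem hp]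
      simp
  · rw [top_le_iff, Submodule.topologicalClosure_eq_top_iff, Submodule.eq_bot_iff]
    intro g hg
    have h : ∀ p : pointGroup Γ × dualLattice Γ,
        ∀ᵐ y, (dualIsom p)⁻¹ y ∈ Ω → g y = 0 := by
      intro p
      obtain ⟨a, ha⟩ := exists_embedCell_eq γ hm p g
      have h1 : ⟪embedCell γ hm p a, g⟫_ℂ = 0 := hg _ (Submodule.mem_iSup_of_mem p ⟨_, rfl⟩)
      -- The inner product of g with its truncation to the cell is the squared norm of the
      -- truncation.
      have h2 : ⟪embedCell γ hm p a, embedCell γ hm p a⟫_ℂ = 0 := by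
        rw [← h1, L2.inner_def, L2.inner_def]
        refine integral_congr_ae ?_
        filter_upwards [ha] with y hy
        rw [hy]
        by_cases hm : y ∈ (fun y => (dualIsom p)⁻¹ y) ⁻¹' Ω
        · rw [Set.indicator_of_mem hm]
        · rw [Set.indicator_of_notMem hm, inner_zero_left, inner_zero_left]
      rw [inner_self_eq_zero] at h2
      rw [h2] at ha
      filter_upwards [ha, Lp.coeFn_zero ℂ 2 (volume : Measure (Eucl n))] with y h3 h4 hy
      rw [h4, Set.indicator_of_mem (by exact hy)] at h3
      exact h3.symm
    refine Lp.ext ?_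
    filter_upwards [ae_all_iff.2 h, Lp.coeFn_zero ℂ 2 (volume : Measure (Eucl n))] with y h1 h2
    obtain ⟨p, hp⟩ := exists_inv_mem_of_isFundamentalSet hΩ y
    rw [h1 p hp, h2]
    rfl

section Intertwiner

variable [Countable (pointGroup Γ × dualLattice Γ)] {γ : pointGroup Γ → Γ}
  {hm : NullMeasurableSet Ω}

/-- The intertwiner `U : L²(ℝⁿ) → L²(Ω; l²(Π) ⊗ l²(𝓛*))`. -/
def intertwiner (hJ : IsHilbertSum ℂ (fun _ : pointGroup Γ × dualLattice Γ => ScalarL2 Ω)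
    (embedCell γ hm)) : L2 n ≃ₗᵢ[ℂ] L2Fiber Γ Ω :=
  hJ.linearIsometryEquiv.trans isHilbertSum_coordEmbed.linearIsometryEquiv.symm

variable (hJ : IsHilbertSum ℂ (fun _ : pointGroup Γ × dualLattice Γ => ScalarL2 Ω)
    (embedCell γ hm))

theorem hasSum_intertwiner_symm (f : L2Fiber Γ Ω) :
    HasSum (fun p => embedCell γ hm p (coordL Ω p f)) ((intertwiner hJ).symm f) := by
  have h := hJ.hasSum_linearIsometryEquiv_symm
    ((isHilbertSum_coordEmbed (Γ := Γ) (Ω := Ω)).linearIsometryEquiv f)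
  simp_rw [isHilbertSum_coordEmbed_apply] at h
  exact h

theorem intertwiner_symm_coordEmbed (p : pointGroup Γ × dualLattice Γ) (a : ScalarL2 Ω) :
    (intertwiner hJ).symm (coordEmbed Ω p a) = embedCell γ hm p a := by
  refine (hasSum_intertwiner_symm hJ (coordEmbed Ω p a)).unique ?_
  have h := hasSum_single (f := fun q => embedCell γ hm q (coordL Ω q (coordEmbed Ω p a))) p
    (fun q hq => by rw [coordL_coordEmbed_ne hq, map_zero])
  rwa [coordL_coordEmbed_self] at h

/-- Reindexing of `Γ*`: `[z, M]` corresponds to the cell of `[M⁻¹ z, M]`. -/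
def cellEquiv (Γ : Subgroup (Isom n)) :
    dualLattice Γ × pointGroup Γ ≃ pointGroup Γ × dualLattice Γ where
  toFun p := (p.2, invAct p.2 p.1)
  invFun q := (⟨q.1.1 q.2.1, map_mem_dualLattice q.1.2 q.2.2⟩, q.1)
  left_inv _ := Prod.ext (Subtype.ext (apply_inv_apply _ _)) rfl
  right_inv _ := Prod.ext rfl (Subtype.ext (inv_apply_apply _ _))

omit [Countable (pointGroup Γ × dualLattice Γ)] in
theorem embedCell_cellEquiv_ae (f : L2Fiber Γ Ω) (p : dualLattice Γ × pointGroup Γ) :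
    embedCell γ hm (cellEquiv Γ p) (coordL Ω (cellEquiv Γ p) f) =ᵐ[volume]
      mulX γ p.2 (pPrime Ω (coeff (invAct p.2 p.1) p.2 f) p.1 p.2) := by
  filter_upwards [coeFn_embedCell γ hm (cellEquiv Γ p) (coordL Ω (cellEquiv Γ p) f),
    (measurePreserving_isom (dualIsom (cellEquiv Γ p))⁻¹).quasiMeasurePreserving.ae_eq
      (indicator_ae_eq_of_restrict hm (coeFn_coordL (cellEquiv Γ p) f))] with y h1 h2
  rw [h1]
  simp only [Function.comp_apply] at h2
  rw [h2, dualIsom_inv_apply, mulX, pPrime, map_sub]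
  rfl

/-- The summands are prescribed almost everywhere, so they and their sum are unique; up to
reindexing they are the terms of the cell expansion. -/
theorem isOrthSum_iff (f : L2Fiber Γ Ω) (g : L2 n) :
    IsOrthSum γ f g ↔ g = (intertwiner hJ).symm f := by
  have hs := ((cellEquiv Γ).hasSum_iff
    (f := fun p => embedCell γ hm p (coordL Ω p f))).2 (hasSum_intertwiner_symm hJ f)
  constructor
  · rintro ⟨c, hc, -, hsum⟩
    refine hsum.unique ?_
    convert hs using 1
    funext p
    exact Lp.ext ((hc p).trans (embedCell_cellEquiv_ae f p).symm)
  · rintro rfl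
    refine ⟨_, embedCell_cellEquiv_ae (hm := hm) f, fun p q hpq => ?_, hs⟩
    exact hJ.OrthogonalFamily (fun h => hpq ((cellEquiv Γ).injective h)) _ _

/-! ### The action of Γ in cell coordinates -/

/-- The cocycle `ℓ` of translations attached to a cross-section. -/
def cocycle (γ : pointGroup Γ → Γ) (g : Isom n) (M N : pointGroup Γ) : Eucl n :=
  M.1⁻¹ (g 0) + transPart (γ N).1 - transPart (γ M).1

-- The element γ(M)⁻¹ g γ(N) of Γ has trivial linear part, and the cocycle is its translation
-- vector.
omit [Countable (pointGroup Γ × dualLattice Γ)] in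
theorem cocycle_mem_lattice (hγ : IsCrossSection Γ γ) {g : Isom n} (hg : g ∈ Γ)
    {M N : pointGroup Γ} (h : linPart n g * N.1 = M.1) : cocycle γ g M N ∈ lattice Γ := by
  refine ⟨(γ M).1⁻¹ * g * (γ N).1, Γ.mul_mem (Γ.mul_mem (Γ.inv_mem (γ M).2) hg) (γ N).2,
    fun z => (γ M).1.injective ?_⟩
  have h1 : (γ M).1 (((γ M).1⁻¹ * g * (γ N).1) z) = g ((γ N).1 z) :=
    (γ M).1.apply_symm_apply _
  rw [h1, isom_apply' (γ N).1, isom_apply' (γ M).1, hγ.lin, hγ.lin, isom_apply g]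
  change linPart n g _ + _ = _
  rw [← mul_apply', h]
  apply M.1⁻¹.injective
  rw [map_add, inv_apply_apply, inv_apply_apply, cocycle]
  abel

theorem memLp_indicator_chi {E : Set (Eucl n)} (hE : MeasurableSet E) (x : Eucl n)
    {μ : Measure (Eucl n)} : MemLp (E.indicator fun ω => chi ω x) ∞ μ := (memLp_chi x).indicator hE

theorem memLp_indicator_one {E : Set (Eucl n)} (hE : MeasurableSet E)
    {μ : Measure (Eucl n)} : MemLp (E.indicator fun _ => (1 : ℂ)) ∞ μ :=
  (memLp_top_const 1).indicator hE

/-- Cutting down a shifted function to a periodic set moves one slice of its fibers to another. -/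
theorem mulOp_periodicSet_dualShift (hR : IsFundamentalDomain (dualCrystalGroup Γ) R)
    (hΩ : IsFundamentalSet (dualCrystalGroup Γ) Ω) (hae : Ω =ᵐ[volume] R)
    (hγ : IsCrossSection Γ γ) {g : Isom n} (hg : g ∈ Γ) {M N : pointGroup Γ}
    (h : linPart n g * N.1 = M.1) {E : Set (Eucl n)} (hER : E ⊆ R) (hE : MeasurableSet E)
    (hB : MeasurableSet (periodicSet M E)) (f : L2Fiber Γ Ω) :
    mulOp ((periodicSet M E).indicator fun _ => 1) (memLp_indicator_one hB)
        (dualShift g ((intertwiner hJ).symm f)) =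
      (intertwiner hJ).symm (sliceOp Ω (E.indicator fun ω => chi ω (cocycle γ g M N))
        (memLp_indicator_chi hE _) M N f) := by
  have hℓ := cocycle_mem_lattice hγ hg h
  -- Both sides are bounded linear in f, so one coordinate at a time suffices; the coordinate
  -- expansion of f then gives the general case.
  have hcell : ∀ (q : pointGroup Γ × dualLattice Γ) (a : ScalarL2 Ω),
      mulOp ((periodicSet M E).indicator fun _ => 1) (memLp_indicator_one hB)
        (dualShift g ((intertwiner hJ).symm (coordEmbed Ω q a))) =
      (intertwiner hJ).symm (sliceOp Ω (E.indicator fun ω => chi ω (cocycle γ g M N))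
        (memLp_indicator_chi hE _) M N (coordEmbed Ω q a)) := by
    rintro ⟨N', w⟩ a
    rw [intertwiner_symm_coordEmbed]
    have hshift : ∀ᵐ y, dualShift g (embedCell γ hm (N', w) a) y =
        chi y (g 0) * (chi (N'.1⁻¹ ((linPart n g)⁻¹ y)) (transPart (γ N').1) *
          Ω.indicator a (N'.1⁻¹ ((linPart n g)⁻¹ y) - w.1)) := by
      filter_upwards [coeFn_dualShift g (embedCell γ hm (N', w) a),
        (linPart n g)⁻¹.measurePreserving.quasiMeasurePreserving.ae_eq
          (coeFn_embedCell γ hm (N', w) a)] with y h1 h2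
      simp only [Function.comp_apply] at h2
      rw [h1, h2, dualIsom_inv_apply]
    have hL : linPart n g ∈ pointGroup Γ := ⟨g, hg, rfl⟩
    -- The shift moves the cell of (N', w) to the cell of (LN', w), leaving w unchanged.
    have hinv (y : Eucl n) : N'.1⁻¹ ((linPart n g)⁻¹ y) - w.1 =
        (dualIsom ((⟨linPart n g, hL⟩ * N', w) : pointGroup Γ × dualLattice Γ))⁻¹ y := by
      rw [dualIsom_inv_apply]
      change _ = (linPart n g * N'.1)⁻¹ y - w.1
      rw [mul_inv_rev]
      rfl
    by_cases hN : N' = N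
    · subst hN
      have hM : (⟨linPart n g, hL⟩ * N' : pointGroup Γ) = M := Subtype.ext h
      rw [hM] at hinv
      rw [sliceOp_coordEmbed_self, intertwiner_symm_coordEmbed]
      refine Lp.ext ?_
      filter_upwards [coeFn_mulOp ((periodicSet M E).indicator fun _ => (1 : ℂ))
        (memLp_indicator_one hB) (dualShift g (embedCell γ hm (N', w) a)), hshift,
        coeFn_embedCell γ hm (M, w) (mulOp (E.indicator fun ω => chi ω (cocycle γ g M N'))
          (memLp_indicator_chi hE _) a),
        (measurePreserving_isom (dualIsom (M, w))⁻¹).quasiMeasurePreserving.ae_eq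
          (indicator_ae_eq_of_restrict hm (coeFn_mulOp (E.indicator fun ω =>
            chi ω (cocycle γ g M N')) (memLp_indicator_chi hE _) a)),
        ae_unique_cell hR hΩ hae] with y h1 h2 h3 h4 h5
      obtain ⟨r, hrR, hrΩ, hr⟩ := h5
      simp only [Function.comp_apply] at h4
      rw [h1, h2, h3, h4, hinv]
      by_cases hy : (dualIsom (M, w))⁻¹ y ∈ Ω
      · obtain rfl := hr _ hy
        rw [Set.indicator_of_mem hy, Set.indicator_of_mem hy]
        by_cases hyE : (dualIsom (M, w))⁻¹ y ∈ E
        · rw [Set.indicator_of_mem ((mem_periodicSet_iff hR hER hrR).2 ⟨rfl, hyE⟩),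
            Set.indicator_of_mem hyE]
          have e1 : N'.1⁻¹ ((linPart n g)⁻¹ y) = M.1⁻¹ y := by
            rw [← h, mul_inv_rev]
            rfl
          -- The cocycle lies in 𝓛 and w in 𝓛*, so the scalar is the same on all cells with linear
          -- part M.
          have e2 : chi ((dualIsom (M, w))⁻¹ y) (cocycle γ g M N') =
              chi (M.1⁻¹ y) (cocycle γ g M N') := by
            have e3 : M.1⁻¹ y = (dualIsom (M, w))⁻¹ y + w.1 := by
              rw [dualIsom_inv_apply, sub_add_cancel]
            rw [e3, chi_add_left, chi_eq_one w.2 hℓ, mul_one]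
          have e4 : chi y (g 0) = chi (M.1⁻¹ y) (M.1⁻¹ (g 0)) := (chi_map_map _ _ _).symm
          have e5 : chi (M.1⁻¹ y) (M.1⁻¹ (g 0)) * chi (M.1⁻¹ y) (transPart (γ N').1) =
              chi (M.1⁻¹ y) (transPart (γ M).1) * chi (M.1⁻¹ y) (cocycle γ g M N') := by
            rw [← chi_add_right, ← chi_add_right, cocycle, add_sub_cancel]
          rw [e1, e2, e4, one_smul, smul_eq_mul, ← mul_assoc, e5, mul_assoc]
        · rw [Set.indicator_of_notMem (fun hB => hyE ((mem_periodicSet_iff hR hER hrR).1 hB).2),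
            Set.indicator_of_notMem hyE, zero_smul, zero_smul, mul_zero]
      · rw [Set.indicator_of_notMem hy, Set.indicator_of_notMem hy]
        simp
    · rw [sliceOp_coordEmbed_ne _ _ _ hN, map_zero]
      refine Lp.ext ?_
      filter_upwards [coeFn_mulOp ((periodicSet M E).indicator fun _ => (1 : ℂ))
        (memLp_indicator_one hB) (dualShift g (embedCell γ hm (N', w) a)), hshift,
        Lp.coeFn_zero ℂ 2 (volume : Measure (Eucl n)), ae_unique_cell hR hΩ hae] with y h1 h2 h3 h4
      obtain ⟨r, hrR, hrΩ, hr⟩ := h4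
      rw [h1, h2, h3, hinv]
      by_cases hy : (dualIsom ((⟨linPart n g, hL⟩ * N', w) : pointGroup Γ × dualLattice Γ))⁻¹ y ∈ Ω
      · obtain rfl := hr _ hy
        -- The point lies in a cell with linear part LN' ≠ LN = M, which misses the periodic set.
        have hnot : y ∉ periodicSet M E := fun hB => hN (Subtype.ext (mul_left_cancel
          ((congrArg Subtype.val ((mem_periodicSet_iff hR hER hrR).1 hB).1).trans h.symm)))
        rw [Set.indicator_of_notMem hnot, zero_smul]
        rfl
      · rw [Set.indicator_of_notMem hy]
        simp
  have hf := (isHilbertSum_coordEmbed (Γ := Γ) (Ω := Ω)).hasSum_linearIsometryEquiv_symm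
    ((isHilbertSum_coordEmbed (Γ := Γ) (Ω := Ω)).linearIsometryEquiv f)
  rw [LinearIsometryEquiv.symm_apply_apply] at hf
  let A : L2Fiber Γ Ω →L[ℂ] L2 n :=
    mulOp ((periodicSet M E).indicator fun _ => 1) (memLp_indicator_one hB) ∘L
      (dualShift g).toContinuousLinearMap ∘L
        (intertwiner hJ).symm.toContinuousLinearEquiv.toContinuousLinearMap
  let B : L2Fiber Γ Ω →L[ℂ] L2 n :=
    (intertwiner hJ).symm.toContinuousLinearEquiv.toContinuousLinearMap ∘L
      sliceOp Ω (E.indicator fun ω => chi ω (cocycle γ g M N)) (memLp_indicator_chi hE _) M N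
  have h1 := hf.mapL A
  have h2 := hf.mapL B
  refine (h1.unique ?_ : A f = B f)
  convert h2 using 1
  funext q
  exact hcell q _

end Intertwiner

/-! ### Invariant subspaces on the Fourier side -/

/-- Invariance of a subspace under the transported representation. -/
def IsDualShiftInvariant (Γ : Subgroup (Isom n)) (V : Submodule ℂ (L2 n)) : Prop :=
  ∀ g ∈ Γ, ∀ h ∈ V, dualShift g h ∈ V

theorem dualShift_one (h : L2 n) : dualShift 1 h = h := by
  refine Lp.ext ?_
  filter_upwards [coeFn_dualShift 1 h] with y hy
  rw [hy]
  have h1 : (1 : Isom n) 0 = 0 := rfl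
  rw [h1, chi_zero_right, one_mul, map_one]
  rfl

/-- For k orthogonal to V, translation invariance makes the density ⟪k, h⟫ orthogonal to all
characters of 𝓛, so its integral over the periodic set vanishes. The truncated function is thus
orthogonal to Vᗮ, and V is closed. -/
theorem IsDualShiftInvariant.mulOp_periodicSet_mem {V : Submodule ℂ (L2 n)}
    (hV : IsDualShiftInvariant Γ V) (hVc : IsClosed (V : Set (L2 n)))
    (hR : IsFundamentalDomain (dualCrystalGroup Γ) R) [Countable (lattice Γ)]
    {E : Set (Eucl n)} (hER : E ⊆ R) (hE : MeasurableSet E) (M : pointGroup Γ)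
    (hB : MeasurableSet (periodicSet M E)) {h : L2 n} (hh : h ∈ V) :
    mulOp ((periodicSet M E).indicator fun _ => 1) (memLp_indicator_one hB) h ∈ V := by
  have := hVc.completeSpace_coe
  rw [← V.orthogonal_orthogonal]
  intro k hk
  have h1 : ∫ y in periodicSet M E, ⟪k y, h y⟫_ℂ = 0 := by
    refine setIntegral_periodicSet_eq_zero hR hER hE M (L2.integrable_inner k h) ?_
    rintro x ⟨t, ht, htx⟩
    have h2 := (V.mem_orthogonal' k).1 hk _ (hV t ht h hh)
    rw [L2.inner_def] at h2
    rw [← h2]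
    refine integral_congr_ae ?_
    have h3 : linPart n t = 1 := by
      ext1 y
      have h4 := isom_apply t y
      rw [htx, htx, zero_add] at h4
      exact (add_right_cancel h4).symm
    filter_upwards [coeFn_dualShift t h] with y hy
    rw [hy, h3, htx, zero_add, ← smul_eq_mul (chi y x), inner_smul_right, mul_comm]
    rfl
  rw [L2.inner_def, ← h1, ← integral_indicator hB]
  refine integral_congr_ae ?_
  filter_upwards [coeFn_mulOp ((periodicSet M E).indicator fun _ => (1 : ℂ))
    (memLp_indicator_one hB) h] with y hy
  rw [hy]
  by_cases hyB : y ∈ periodicSet M E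
  · rw [Set.indicator_of_mem hyB, Set.indicator_of_mem hyB, one_smul]
  · rw [Set.indicator_of_notMem hyB, Set.indicator_of_notMem hyB, zero_smul, inner_zero_right]

section Intertwiner

variable [Countable (pointGroup Γ × dualLattice Γ)] {γ : pointGroup Γ → Γ}
  {hm : NullMeasurableSet Ω}
  (hJ : IsHilbertSum ℂ (fun _ : pointGroup Γ × dualLattice Γ => ScalarL2 Ω) (embedCell γ hm))

/-- Slices of functions in an invariant subspace are pointwise orthogonal to slices of functions
in its orthogonal complement. -/
theorem ae_inner_slice_eq_zero (hR : IsFundamentalDomain (dualCrystalGroup Γ) R)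
    (hΩ : IsFundamentalSet (dualCrystalGroup Γ) Ω) (hae : Ω =ᵐ[volume] R)
    (hγ : IsCrossSection Γ γ) [Countable (lattice Γ)]
    {V : Submodule ℂ (L2 n)} (hV : IsDualShiftInvariant Γ V) (hVc : IsClosed (V : Set (L2 n)))
    {k f : L2Fiber Γ Ω} (hk : (intertwiner hJ).symm k ∈ Vᗮ) (hf : (intertwiner hJ).symm f ∈ V)
    (M N : pointGroup Γ) :
    ∀ᵐ ω ∂volume.restrict Ω, ⟪slice M (k ω), slice N (f ω)⟫_ℂ = 0 := by
  have := hR.countable_dualLattice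
  -- An element of Γ with linear part MN⁻¹ carries the slice N to the slice M.
  let g : Isom n := (γ (M * N⁻¹)).1
  have hg : g ∈ Γ := (γ (M * N⁻¹)).2
  have hgM : linPart n g * N.1 = M.1 := by
    rw [hγ.lin]
    exact congrArg Subtype.val (inv_mul_cancel_right M N)
  let F : L2Fiber Γ Ω := sliceOp Ω (fun ω => chi ω (cocycle γ g M N)) (memLp_chi _) M N f
  have hF := coeFn_sliceOp (fun ω => chi ω (cocycle γ g M N)) (memLp_chi _) M N f
  -- Cutting the shifted function down to ME + 𝓛* keeps it in V, and in cell coordinates this is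
  -- restriction of F to E. Vanishing of the integral for every such E forces the integrand to
  -- vanish almost everywhere.
  have h0 : ∀ E, MeasurableSet E → E ⊆ R →
      ∫ ω in E, ⟪k ω, F ω⟫_ℂ ∂volume.restrict Ω = 0 := by
    intro E hE hER
    have hB := measurableSet_periodicSet M hE
    have h1 := hV.mulOp_periodicSet_mem hVc hR hER hE M hB (hV g hg _ hf)
    rw [mulOp_periodicSet_dualShift hJ hR hΩ hae hγ hg hgM hER hE hB] at h1
    have h2 := (V.mem_orthogonal' _).1 hk _ h1
    rw [LinearIsometryEquiv.inner_map_map, L2.inner_def] at h2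
    rw [← h2, ← integral_indicator hE]
    refine integral_congr_ae ?_
    filter_upwards [hF, coeFn_sliceOp (E.indicator fun ω => chi ω (cocycle γ g M N))
      (memLp_indicator_chi hE _) M N f] with ω h3 h4
    rw [h4]
    by_cases hω : ω ∈ E
    · rw [Set.indicator_of_mem hω, Set.indicator_of_mem hω]
      exact congrArg _ h3
    · rw [Set.indicator_of_notMem hω, Set.indicator_of_notMem hω, zero_smul, inner_zero_right]
  have hR' : volume.restrict Ω = volume.restrict R := Measure.restrict_congr_set hae
  have h1 : (fun ω => ⟪k ω, F ω⟫_ℂ) =ᵐ[volume.restrict Ω] 0 := by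
    refine (L2.integrable_inner k F).ae_eq_zero_of_forall_setIntegral_eq_zero fun s hs _ => ?_
    rw [← h0 (s ∩ R) (hs.inter hR.isOpen.measurableSet) Set.inter_subset_right]
    refine setIntegral_congr_set ?_
    have h2 : ∀ᵐ ω ∂volume.restrict Ω, ω ∈ R := by
      rw [hR']
      exact ae_restrict_mem hR.isOpen.measurableSet
    filter_upwards [h2] with ω hω
    exact propext ⟨fun h => ⟨h, hω⟩, fun h => h.1⟩
  filter_upwards [h1, hF] with ω h2 h3
  have h4 : ⟪k ω, F ω⟫_ℂ = 0 := h2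
  rw [show F ω = _ from h3, inner_smul_right, inner_moveSlice] at h4
  exact (mul_eq_zero.1 h4).resolve_left (chi_ne_zero _ _)

/-- Direct integrals of subspaces `l²(Π) ⊗ F_ω` are invariant. -/
theorem directIntegral_invariant (hR : IsFundamentalDomain (dualCrystalGroup Γ) R)
    (hΩ : IsFundamentalSet (dualCrystalGroup Γ) Ω) (hae : Ω =ᵐ[volume] R)
    (hγ : IsCrossSection Γ γ) {W : Eucl n → Submodule ℂ (Fiber Γ)}
    (hW : ∀ᵐ ω ∂volume.restrict Ω, ∃ F : Submodule ℂ (ellDual Γ),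
      IsClosed (F : Set (ellDual Γ)) ∧ W ω = tensorSubspace F)
    {g : Isom n} (hg : g ∈ Γ) {f : L2Fiber Γ Ω} (hf : f ∈ directIntegral Ω W) :
    intertwiner hJ (dualShift g ((intertwiner hJ).symm f)) ∈ directIntegral Ω W := by
  have := hR.countable_dualLattice
  have := hR.countable_pointGroup
  set f' := intertwiner hJ (dualShift g ((intertwiner hJ).symm f)) with hf'
  have hRm := hR.isOpen.measurableSet
  have hL : linPart n g ∈ pointGroup Γ := ⟨g, hg, rfl⟩
  have hslice : ∀ᵐ ω ∂volume.restrict Ω, ∀ M : pointGroup Γ,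
      ∃ N : pointGroup Γ, ∃ c : ℂ, slice M (f' ω) = c • slice N (f ω) := by
    rw [ae_all_iff]
    intro M
    let N : pointGroup Γ := ⟨linPart n g, hL⟩⁻¹ * M
    have hN : linPart n g * N.1 = M.1 :=
      congrArg Subtype.val (mul_inv_cancel_left (⟨linPart n g, hL⟩ : pointGroup Γ) M)
    have hM : linPart n (1 : Isom n) * M.1 = M.1 := by rw [map_one, one_mul]
    have hB := measurableSet_periodicSet M hRm
    have h1 := mulOp_periodicSet_dualShift hJ hR hΩ hae hγ hg hN subset_rfl hRm hB f
    -- The same formula for the identity element extracts the slice M of f' itself; equating the two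
    -- expressions gives the slice of f' as a scalar multiple of a slice of f.
    have h2 := mulOp_periodicSet_dualShift hJ hR hΩ hae hγ Γ.one_mem hM subset_rfl hRm hB f'
    rw [dualShift_one, hf', LinearIsometryEquiv.symm_apply_apply, ← hf', h1] at h2
    have h3 := (intertwiner hJ).symm.injective h2
    have hmem : ∀ᵐ ω ∂volume.restrict Ω, ω ∈ R := by
      rw [Measure.restrict_congr_set hae]
      exact ae_restrict_mem hRm
    filter_upwards [coeFn_sliceOp (R.indicator fun ω => chi ω (cocycle γ g M N))
      (memLp_indicator_chi hRm _) M N f,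
      coeFn_sliceOp (R.indicator fun ω => chi ω (cocycle γ 1 M M))
      (memLp_indicator_chi hRm _) M M f', hmem] with ω h4 h5 hω
    rw [← h3, h4, Set.indicator_of_mem hω, Set.indicator_of_mem hω] at h5
    have h6 := congrArg (slice M) h5
    rw [map_smul, map_smul, slice_moveSlice, slice_moveSlice] at h6
    refine ⟨N, (chi ω (cocycle γ 1 M M))⁻¹ * chi ω (cocycle γ g M N), ?_⟩
    rw [mul_smul, h6, smul_smul, inv_mul_cancel₀ (chi_ne_zero _ _), one_smul]
  have hf0 : ∀ᵐ ω ∂volume.restrict Ω, f ω ∈ W ω := hf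
  change ∀ᵐ ω ∂volume.restrict Ω, f' ω ∈ W ω
  filter_upwards [hslice, hW, hf0] with ω h1 h2 h3
  obtain ⟨F, hF, hWF⟩ := h2
  rw [hWF, mem_tensorSubspace hF] at h3 ⊢
  intro M
  obtain ⟨N, c, h⟩ := h1 M
  rw [h]
  exact F.smul_mem c (h3 N)

end Intertwiner

/-! ### The range function of an invariant subspace -/

/-- The closed span of all slices of the values at `ω` of a sequence of functions. -/
def sliceSpan (s : ℕ → L2Fiber Γ Ω) (ω : Eucl n) : Submodule ℂ (ellDual Γ) :=
  (Submodule.span ℂ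
    (Set.range fun q : pointGroup Γ × ℕ => slice q.1 (s q.2 ω))).topologicalClosure

theorem isClosed_sliceSpan (s : ℕ → L2Fiber Γ Ω) (ω : Eucl n) :
    IsClosed (sliceSpan s ω : Set (ellDual Γ)) := Submodule.isClosed_topologicalClosure _

theorem slice_mem_sliceSpan (s : ℕ → L2Fiber Γ Ω) (ω : Eucl n) (M : pointGroup Γ) (j : ℕ) :
    slice M (s j ω) ∈ sliceSpan s ω :=
  Submodule.le_topologicalClosure _ (Submodule.subset_span ⟨(M, j), rfl⟩)

theorem mem_orthogonal_sliceSpan {s : ℕ → L2Fiber Γ Ω} {ω : Eucl n} {u : ellDual Γ}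
    (h : ∀ N j, ⟪u, slice N (s j ω)⟫_ℂ = 0) : u ∈ (sliceSpan s ω)ᗮ := by
  rw [sliceSpan, Submodule.orthogonal_closure, Submodule.mem_orthogonal']
  have h1 : Submodule.span ℂ (Set.range fun q : pointGroup Γ × ℕ => slice q.1 (s q.2 ω)) ≤
      (Submodule.span ℂ {u})ᗮ := by
    rw [Submodule.span_le]
    rintro _ ⟨⟨N, j⟩, rfl⟩
    exact Submodule.mem_orthogonal_singleton_iff_inner_right.2 (h N j)
  exact fun v hv => Submodule.mem_orthogonal_singleton_iff_inner_right.1 (h1 hv)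

/-- An L² convergent sequence has a subsequence converging almost everywhere, and the fibers are
closed. -/
theorem ae_mem_of_mem_closure {s : ℕ → L2Fiber Γ Ω} {f : L2Fiber Γ Ω}
    (hf : f ∈ closure (Set.range s)) :
    ∀ᵐ ω ∂volume.restrict Ω, f ω ∈ tensorSubspace (sliceSpan s ω) := by
  obtain ⟨x, hx, hlim⟩ := mem_closure_iff_seq_limit.1 hf
  choose j hj using hx
  obtain ⟨ns, -, hns⟩ := (tendstoInMeasure_of_tendsto_Lp hlim).exists_seq_tendsto_ae
  filter_upwards [hns] with ω hω
  refine (isClosed_tensorSubspace (sliceSpan s ω)).mem_of_tendsto hω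
    (Filter.Eventually.of_forall fun i => ?_)
  refine (mem_tensorSubspace (isClosed_sliceSpan s ω)).2 fun M => ?_
  rw [← hj]
  exact slice_mem_sliceSpan s ω M _

/-- A positive square integrable function. -/
def weight (n : ℕ) (ω : Eucl n) : ℝ := (1 + ‖ω‖) ^ (-((n : ℝ) + 1))

theorem weight_pos (ω : Eucl n) : 0 < weight n ω :=
  Real.rpow_pos_of_pos (by positivity) _

theorem memLp_weight : MemLp (fun ω : Eucl n => (weight n ω : ℂ)) 2 volume := by
  have hc : Continuous (weight n) :=
    (continuous_const.add continuous_norm).rpow_const fun x =>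
      Or.inl (add_pos_of_pos_of_nonneg one_pos (norm_nonneg x)).ne'
  have h : MemLp (weight n) 2 volume := by
    refine (memLp_two_iff_integrable_sq hc.aestronglyMeasurable).2 ?_
    have h1 : (fun ω : Eucl n => weight n ω ^ 2) =
        fun ω => (1 + ‖ω‖) ^ (-(2 * ((n : ℝ) + 1))) := by
      funext ω
      rw [weight, ← Real.rpow_natCast, ← Real.rpow_mul (by positivity)]
      congr 1
      push_cast
      ring
    rw [h1]
    -- The squared weight decays with exponent 2(n + 1), which exceeds the dimension n.
    refine integrable_one_add_norm ?_
    rw [finrank_euclideanSpace_fin]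
    have : (0 : ℝ) ≤ n := n.cast_nonneg
    linarith
  exact h.ofReal

section RangeFunction

variable {K : Submodule ℂ (L2Fiber Γ Ω)} [CompleteSpace K] {W : Eucl n → Submodule ℂ (Fiber Γ)}

/-- A closed subspace is the direct integral of a family of fibers as soon as it and its orthogonal
complement take values in the fibers and in their orthogonal complements. -/
theorem directIntegral_eq (h1 : ∀ f ∈ K, ∀ᵐ ω ∂volume.restrict Ω, f ω ∈ W ω)
    (h2 : ∀ f ∈ Kᗮ, ∀ᵐ ω ∂volume.restrict Ω, f ω ∈ (W ω)ᗮ) : directIntegral Ω W = K := by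
  refine Set.Subset.antisymm (fun f hf => ?_) (fun f hf => h1 f hf)
  have hf' : ∀ᵐ ω ∂volume.restrict Ω, f ω ∈ W ω := hf
  have h3 : f - K.starProjection f = 0 := by
    refine Lp.ext ?_
    filter_upwards [hf', h1 _ (K.starProjection_apply_mem f),
      h2 _ (K.sub_starProjection_mem_orthogonal f), Lp.coeFn_sub f (K.starProjection f),
      Lp.coeFn_zero (Fiber Γ) 2 (volume.restrict Ω)] with ω k1 k2 k3 k4 k5
    rw [k5]
    have k6 : (f - K.starProjection f : L2Fiber Γ Ω) ω ∈ W ω := by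
      rw [k4]
      exact (W ω).sub_mem k1 k2
    exact inner_self_eq_zero.1 (k3 _ k6)
  rw [sub_eq_zero.1 h3]
  exact K.starProjection_apply_mem f

/-- Under these conditions the projection onto K acts fiberwise as the projection onto W ω.
Projecting the weighted constant function with value a and dividing by the weight exhibits the fiber
projections of a as measurable; the weight makes the constant square integrable without any
finiteness of the measure of Ω. -/
theorem isMeasurableRangeFunction_of_ae (hc : ∀ ω, IsClosed (W ω : Set (Fiber Γ)))
    (h1 : ∀ f ∈ K, ∀ᵐ ω ∂volume.restrict Ω, f ω ∈ W ω)
    (h2 : ∀ f ∈ Kᗮ, ∀ᵐ ω ∂volume.restrict Ω, f ω ∈ (W ω)ᗮ) :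
    IsMeasurableRangeFunction Ω W where
  closed ω _ := hc ω
  measurable a b := by
    have hw : MemLp (fun ω : Eucl n => (weight n ω : ℂ)) 2 (volume.restrict Ω) :=
      memLp_weight.restrict Ω
    let A : L2Fiber Γ Ω := (ContinuousLinearMap.toSpanSingleton ℂ a).compLpL 2 _ hw.toLp
    have hA : A =ᵐ[volume.restrict Ω] fun ω => (weight n ω : ℂ) • a := by
      filter_upwards [(ContinuousLinearMap.toSpanSingleton ℂ a).coeFn_compLpL (p := 2) hw.toLp,
        hw.coeFn_toLp] with ω k1 k2
      rw [show A ω = _ from k1, k2, ContinuousLinearMap.toSpanSingleton_apply]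
    have hmeas : AEMeasurable (fun ω => ((weight n ω : ℂ)⁻¹ • ⟪(K.starProjection A) ω, b⟫_ℂ))
        (volume.restrict Ω) := by
      refine AEMeasurable.smul hw.1.aemeasurable.inv ?_
      exact ((Lp.aestronglyMeasurable _).inner aestronglyMeasurable_const).aemeasurable
    refine hmeas.congr ?_
    filter_upwards [hA, h1 _ (K.starProjection_apply_mem A),
      h2 _ (K.sub_starProjection_mem_orthogonal A), Lp.coeFn_sub A (K.starProjection A)]
      with ω k1 k2 k3 k4
    rw [k4, Pi.sub_apply, k1, ← Submodule.orthogonal_closure] at k3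
    have k5 := Submodule.eq_starProjection_of_mem_orthogonal
      ((W ω).le_topologicalClosure k2) k3
    rw [← k5, map_smul, inner_smul_left, Complex.conj_ofReal, smul_eq_mul,
      inv_mul_cancel_left₀ (Complex.ofReal_ne_zero.2 (weight_pos ω).ne')]

end RangeFunction

section Intertwiner

variable [Countable (pointGroup Γ × dualLattice Γ)] {γ : pointGroup Γ → Γ}
  {hm : NullMeasurableSet Ω}
  (hJ : IsHilbertSum ℂ (fun _ : pointGroup Γ × dualLattice Γ => ScalarL2 Ω) (embedCell γ hm))

/-- An invariant closed subspace is the direct integral of a measurable range function with fibers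
`l²(Π) ⊗ F_ω`. -/
theorem exists_rangeFunction (hR : IsFundamentalDomain (dualCrystalGroup Γ) R)
    (hΩ : IsFundamentalSet (dualCrystalGroup Γ) Ω) (hae : Ω =ᵐ[volume] R)
    (hγ : IsCrossSection Γ γ) [Countable (lattice Γ)]
    {V : Submodule ℂ (L2 n)} (hV : IsDualShiftInvariant Γ V) (hVc : IsClosed (V : Set (L2 n))) :
    ∃ W : Eucl n → Submodule ℂ (Fiber Γ), IsMeasurableRangeFunction Ω W ∧
      (∀ ω, ∃ F : Submodule ℂ (ellDual Γ), IsClosed (F : Set (ellDual Γ)) ∧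
        W ω = tensorSubspace F) ∧
      ∀ f, f ∈ directIntegral Ω W ↔ (intertwiner hJ).symm f ∈ V := by
  have := hR.countable_pointGroup
  have : Fact ((2 : ℝ≥0∞) ≠ ∞) := ⟨ENNReal.ofNat_ne_top⟩
  have : SecondCountableTopology (L2 n) := Lp.SecondCountableTopology
  let U := intertwiner hJ
  let K : Submodule ℂ (L2Fiber Γ Ω) := V.comap U.symm.toLinearEquiv.toLinearMap
  have hK : ∀ f, f ∈ K ↔ U.symm f ∈ V := fun _ => Iff.rfl
  have hKc : IsClosed (K : Set (L2Fiber Γ Ω)) := hVc.preimage U.symm.continuous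
  have := hKc.completeSpace_coe
  -- Elements of L² have no canonical pointwise values, so the fibers are defined from one countable
  -- dense family; the later statements then involve only countably many null sets.
  let s : ℕ → L2Fiber Γ Ω := fun j => U (TopologicalSpace.denseSeq V j : L2 n)
  have hs : ∀ j, U.symm (s j) ∈ V := fun j => by
    rw [LinearIsometryEquiv.symm_apply_apply]
    exact (TopologicalSpace.denseSeq V j).2
  have h1 : ∀ f ∈ K, ∀ᵐ ω ∂volume.restrict Ω, f ω ∈ tensorSubspace (sliceSpan s ω) := by
    intro f hf
    refine ae_mem_of_mem_closure ?_
    have h2 := (TopologicalSpace.denseRange_denseSeq V) ⟨U.symm f, hf⟩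
    have h3 : Continuous fun v : V => U (v : L2 n) := U.continuous.comp continuous_subtype_val
    have h4 := image_closure_subset_closure_image h3 ⟨_, h2, rfl⟩
    rw [← Set.range_comp] at h4
    simpa using! h4
  have h2 : ∀ k ∈ Kᗮ, ∀ᵐ ω ∂volume.restrict Ω, k ω ∈ (tensorSubspace (sliceSpan s ω))ᗮ := by
    intro k hk
    have hk' : U.symm k ∈ Vᗮ := by
      rw [Submodule.mem_orthogonal']
      intro v hv
      have h3 : U v ∈ K := by rwa [hK, LinearIsometryEquiv.symm_apply_apply]
      rw [← U.inner_map_map, LinearIsometryEquiv.apply_symm_apply]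
      exact (K.mem_orthogonal' k).1 hk _ h3
    have h3 : ∀ᵐ ω ∂volume.restrict Ω, ∀ M N j, ⟪slice M (k ω), slice N (s j ω)⟫_ℂ = 0 := by
      refine ae_all_iff.2 fun M => ae_all_iff.2 fun N => ae_all_iff.2 fun j => ?_
      exact ae_inner_slice_eq_zero hJ hR hΩ hae hγ hV hVc hk' (hs j) M N
    filter_upwards [h3] with ω hω
    exact mem_orthogonal_tensorSubspace.2 fun M => mem_orthogonal_sliceSpan (hω M)
  refine ⟨fun ω => tensorSubspace (sliceSpan s ω),
    isMeasurableRangeFunction_of_ae (fun ω => isClosed_tensorSubspace _) h1 h2,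
    fun ω => ⟨_, isClosed_sliceSpan s ω, rfl⟩, fun f => ?_⟩
  rw [directIntegral_eq h1 h2]
  exact hK f

end Intertwiner

end Crystal

end

/-! ### Transfer back through the Plancherel transform -/

theorem mainTheorem1 (n : ℕ)
    (Γ : Subgroup (Crystal.Isom n)) (hΓ : Crystal.IsCrystalGroup Γ)
    (R Ω : Set (Crystal.Eucl n))
    (hR : Crystal.IsFundamentalDomain (Crystal.dualCrystalGroup Γ) R) (hRconv : Convex ℝ R)
    (hΩ : Crystal.IsFundamentalSet (Crystal.dualCrystalGroup Γ) Ω)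
    (hRΩ : R ⊆ Ω) (hΩR : Ω ⊆ closure R)
    (γ : Crystal.pointGroup Γ → Γ) (hγ : Crystal.IsCrossSection Γ γ) :
    -- the inverse of the intertwiner is given by the explicit orthogonal sum
    (∃ U : Crystal.L2 n ≃ₗᵢ[ℂ] Crystal.L2Fiber Γ Ω,
      ∀ f : Crystal.L2Fiber Γ Ω, Crystal.IsOrthSum γ f (U.symm f)) ∧
    -- the characterization of the invariant subspaces
    ∀ V : Submodule ℂ (Crystal.L2 n), IsClosed (V : Set (Crystal.L2 n)) →
      (Crystal.IsShiftInvariant Γ V ↔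
        ∃ W : Crystal.Eucl n → Submodule ℂ (Crystal.Fiber Γ),
          Crystal.IsMeasurableRangeFunction Ω W ∧
          (∀ᵐ ω ∂((volume : Measure (Crystal.Eucl n)).restrict Ω),
            ∃ F : Submodule ℂ (Crystal.ellDual Γ),
              IsClosed (F : Set (Crystal.ellDual Γ)) ∧ W ω = Crystal.tensorSubspace F) ∧
          Crystal.plancherel n '' (V : Set (Crystal.L2 n)) =
            {g : Crystal.L2 n | ∃ f ∈ Crystal.directIntegral Ω W, Crystal.IsOrthSum γ f g}) := by
  have := hR.countable_index
  have := hΓ.countable_lattice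
  have hae := Crystal.ae_eq_of_between hR.isOpen hRconv hRΩ hΩR
  have hm : NullMeasurableSet Ω := hR.isOpen.measurableSet.nullMeasurableSet.congr hae.symm
  have hJ := Crystal.isHilbertSum_embedCell γ hm hR hΩ hae
  refine ⟨⟨Crystal.intertwiner hJ, fun f => (Crystal.isOrthSum_iff hJ f _).2 rfl⟩,
    fun V hV => ⟨fun hinv => ?_, ?_⟩⟩
  -- V' is the image of V under the Plancherel transform, written as a preimage under the inverse so
  -- that closedness is immediate.
  · let V' : Submodule ℂ (Crystal.L2 n) :=
      V.comap (Crystal.plancherel n).symm.toLinearEquiv.toLinearMap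
    have hmem : ∀ g, g ∈ V' ↔ (Crystal.plancherel n).symm g ∈ V := fun _ => Iff.rfl
    have hV'c : IsClosed (V' : Set (Crystal.L2 n)) :=
      hV.preimage (Crystal.plancherel n).symm.continuous
    have hV' : Crystal.IsDualShiftInvariant Γ V' := by
      intro g hg h hh
      have h1 := hinv g hg _ ((hmem h).1 hh)
      rwa [hmem, ← (Crystal.plancherel n).apply_symm_apply h, ← Crystal.plancherel_shift,
        LinearIsometryEquiv.symm_apply_apply]
    obtain ⟨W, hW, hWF, hWV⟩ := Crystal.exists_rangeFunction hJ hR hΩ hae hγ hV' hV'c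
    refine ⟨W, hW, Filter.Eventually.of_forall hWF, ?_⟩
    ext g
    constructor
    · rintro ⟨v, hv, rfl⟩
      refine ⟨Crystal.intertwiner hJ (Crystal.plancherel n v), ?_, ?_⟩
      · rwa [hWV, LinearIsometryEquiv.symm_apply_apply, hmem,
          LinearIsometryEquiv.symm_apply_apply]
      · rw [Crystal.isOrthSum_iff hJ, LinearIsometryEquiv.symm_apply_apply]
    · rintro ⟨f, hf, hfg⟩
      rw [Crystal.isOrthSum_iff hJ] at hfg
      rw [hWV, ← hfg] at hf
      exact ⟨_, hf, LinearIsometryEquiv.apply_symm_apply _ _⟩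
  · rintro ⟨W, -, hWF, hWV⟩ g hg v hv
    have h1 : Crystal.plancherel n v ∈ Crystal.plancherel n '' (V : Set (Crystal.L2 n)) :=
      ⟨v, hv, rfl⟩
    rw [hWV] at h1
    obtain ⟨f, hf, hfg⟩ := h1
    rw [Crystal.isOrthSum_iff hJ] at hfg
    have h2 := Crystal.directIntegral_invariant hJ hR hΩ hae hγ hWF hg hf
    have h3 : Crystal.plancherel n (Crystal.shift g v) ∈
        Crystal.plancherel n '' (V : Set (Crystal.L2 n)) := by
      rw [hWV]
      refine ⟨_, h2, ?_⟩
      rw [Crystal.isOrthSum_iff hJ, LinearIsometryEquiv.symm_apply_apply, ← hfg,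
        Crystal.plancherel_shift]
    obtain ⟨u, hu, huv⟩ := h3
    rwa [← (Crystal.plancherel n).injective huv]
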